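/- Let $X$ be a path-connected metric space that is an absolute neighbourhood retract (for metrizable spaces). Let $P(X)$ be the space of paths $[0,1]\to X$ with the uniform metric, and for $x,y\in X$ let $P(x,y)\subset P(X)$ be the set of paths from $x$ to $y$. For $k\ge 1$ and $A\subseteq P(X)$ let $\mathcal B_k(A)$ be the set of Borel probability measures on $P(X)$ supported by at most $k$ points, all of them in $A$, with the Lévy–Prokhorov metric. The distributional topological complexity $\mathrm{dTC}(X)\in\{0,1,2,\dots\}\cup\{\infty\}$ is the least $n$ for which there is a continuous map $s:X\times X\to\mathcal B_{n+1}(P(X))$ with $s(x,y)\in\mathcal B_{n+1}(P(x,y))$ for all $x,y\in X$ (and $\infty$ if there is no such $n$). For a space $Y$ and $m\ge 1$ let $SP^m(Y)=Y^m/S_m$ be the orbit space of the action of the symmetric group by permutation of coordinates, and let $\delta_m:Y\to SP^m(Y)$, $\delta_m(y)=[y,\dots,y]$, be the diagonal inclusion. Cohomology is singular cohomology. A class $\beta\in H^*(X\times X;R)$ is a zero-divisor if $\Delta^*\beta=0$, where $\Delta:X\to X\times X$, $\Delta(x)=(x,x)$. **Theorem.** Let $R$ be a ring, let $n\ge 0$,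 and let $\beta_i^*\in H^{k_i}\big(SP^{n!}(X\times X);R\big)$, $1\le i\le n$, with $k_i\ge 1$, be classes whose images $\beta_i=\delta_{n!}^*(\beta_i^*)\in H^{k_i}(X\times X;R)$ are zero-divisors. If $\beta_1\smile\beta_2\smile\cdots\smile\beta_n\ne 0$, then $\mathrm{dTC}(X)\ge n$. -/

import Mathlib

universe u v

open CategoryTheory Opposite MeasureTheory

noncomputable section

namespace DistTC

/-! ### Singular cohomology with coefficients in a ring, and the cup product -/

/-- Singular `n`-simplices of `X`: the `n`-simplices of Mathlib's singular simplicial set. -/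
abbrev SingularSimplex (X : Type u) [TopologicalSpace X] (n : ℕ) : Type u :=
  (TopCat.toSSet.obj (TopCat.of X)).obj (op (SimplexCategory.mk n))

/-- Singular `n`-cochains of `X` with values in `R`. -/
abbrev Cochain (X : Type u) [TopologicalSpace X] (R : Type v) (n : ℕ) : Type (max u v) :=
  SingularSimplex X n → R

section Cohomology

variable (X : Type u) [TopologicalSpace X] (R : Type v) [Ring R]

/-- The singular coboundary `(d f)(σ) = ∑ i, (-1) ^ i f (∂ᵢ σ)`. -/
def coboundary (n : ℕ) : Cochain X R n →+ Cochain X R (n + 1) where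
  toFun f := fun σ => ∑ i : Fin (n + 2),
    (-1 : R) ^ (i : ℕ) * f ((TopCat.toSSet.obj (TopCat.of X)).map (SimplexCategory.δ i).op σ)
  map_zero' := by ext σ; simp
  map_add' f g := by ext σ; simp [mul_add, Finset.sum_add_distrib]

/-- Singular `n`-cocycles. -/
def cocycles (n : ℕ) : AddSubgroup (Cochain X R n) := (coboundary X R n).ker

/-- Singular `n`-coboundaries. -/
def coboundaries : (n : ℕ) → AddSubgroup (Cochain X R n)
  | 0 => ⊥
  | n + 1 => (coboundary X R n).range

/-- Singular cohomology `Hⁿ(X; R)`: cocycles modulo coboundaries. -/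
abbrev Cohomology (n : ℕ) : Type (max u v) :=
  cocycles X R n ⧸ (coboundaries X R n).addSubgroupOf (cocycles X R n)

end Cohomology

section Pullback

variable {X Y : Type u} [TopologicalSpace X] [TopologicalSpace Y] (R : Type v) [Ring R]

/-- Precomposition of a cochain with `σ ↦ f ∘ σ`. -/
def cochainPullback (f : C(X, Y)) (n : ℕ) : Cochain Y R n →+ Cochain X R n where
  toFun a := fun σ => a ((TopCat.toSSet.map (TopCat.ofHom f)).app _ σ)
  map_zero' := rfl
  map_add' _ _ := rfl

theorem coboundary_cochainPullback (f : C(X, Y)) (n : ℕ) (a : Cochain Y R n) :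
    coboundary X R n (cochainPullback R f n a) =
      cochainPullback R f (n + 1) (coboundary Y R n a) := by
  funext σ
  simp only [coboundary, cochainPullback, AddMonoidHom.coe_mk, ZeroHom.coe_mk]
  refine Finset.sum_congr rfl fun i _ => ?_
  congr 2

/-- `cochainPullback` on cocycles. -/
def cocyclePullback (f : C(X, Y)) (n : ℕ) : cocycles Y R n →+ cocycles X R n :=
  ((cochainPullback R f n).comp (cocycles Y R n).subtype).codRestrict (cocycles X R n)
    (fun a => by
      have ha : coboundary Y R n a = 0 := a.2
      show coboundary X R n (cochainPullback R f n a) = 0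
      rw [coboundary_cochainPullback, ha, map_zero])

/-- The homomorphism `f* : Hⁿ(Y; R) → Hⁿ(X; R)` induced by a continuous map `f : X → Y`. -/
def pullback (f : C(X, Y)) (n : ℕ) : Cohomology Y R n →+ Cohomology X R n :=
  QuotientAddGroup.map _ _ (cocyclePullback R f n) (by
    rintro a ha
    rw [AddSubgroup.mem_addSubgroupOf] at ha
    rw [AddSubgroup.mem_comap, AddSubgroup.mem_addSubgroupOf]
    show cochainPullback R f n a ∈ coboundaries X R n
    cases n with
    | zero =>
      have h0 : (a : Cochain Y R 0) = 0 := ha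
      rw [h0, map_zero]
      exact zero_mem _
    | succ n =>
      obtain ⟨b, hb⟩ := ha
      exact ⟨cochainPullback R f n b, by rw [coboundary_cochainPullback, hb]⟩)

end Pullback

section Cup

variable {X : Type u} [TopologicalSpace X] {R : Type v} [Ring R]

/-- The restriction of a singular simplex to the vertices `j, j + 1, …, j + l`. -/
def subface {n : ℕ} (j l : ℕ) (h : j + l ≤ n) (σ : SingularSimplex X n) : SingularSimplex X l :=
  (TopCat.toSSet.obj (TopCat.of X)).map (SimplexCategory.subinterval j l h).op σ

/-- The cochain cup product `(a ⌣ b)(σ) = a (σ|[0,…,p]) * b (σ|[p,…,p+q])`; the equation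
`p + q = n` is an argument so that no casts between degrees are needed. -/
def cochainCup {p q n : ℕ} (h : p + q = n) (a : Cochain X R p) (b : Cochain X R q) :
    Cochain X R n :=
  fun σ => a (subface 0 p (by omega) σ) * b (subface p q h.le σ)

theorem map_map_eq {l m n l' : ℕ} (f : SimplexCategory.mk l ⟶ SimplexCategory.mk m)
    (g : SimplexCategory.mk m ⟶ SimplexCategory.mk n)
    (f' : SimplexCategory.mk l ⟶ SimplexCategory.mk l')
    (g' : SimplexCategory.mk l' ⟶ SimplexCategory.mk n)
    (h : ∀ i, (g (f i)).val = (g' (f' i)).val) (σ : SingularSimplex X n) :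
    (TopCat.toSSet.obj (TopCat.of X)).map f.op ((TopCat.toSSet.obj (TopCat.of X)).map g.op σ) =
    (TopCat.toSSet.obj (TopCat.of X)).map f'.op
      ((TopCat.toSSet.obj (TopCat.of X)).map g'.op σ) := by
  have h' : f ≫ g = f' ≫ g' := by
    ext i
    exact h i
  rw [← Functor.map_comp_apply, ← Functor.map_comp_apply, ← op_comp, ← op_comp, h']

theorem map_map_eq_single {l m n : ℕ} (f : SimplexCategory.mk l ⟶ SimplexCategory.mk m)
    (g : SimplexCategory.mk m ⟶ SimplexCategory.mk n)
    (g' : SimplexCategory.mk l ⟶ SimplexCategory.mk n)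
    (h : ∀ i, (g (f i)).val = (g' i).val) (σ : SingularSimplex X n) :
    (TopCat.toSSet.obj (TopCat.of X)).map f.op ((TopCat.toSSet.obj (TopCat.of X)).map g.op σ) =
    (TopCat.toSSet.obj (TopCat.of X)).map g'.op σ := by
  have h' : f ≫ g = g' := by
    ext i
    exact h i
  rw [← Functor.map_comp_apply, ← op_comp, h']

theorem δ_val {n : ℕ} (i : Fin (n + 2)) (j : Fin (n + 1)) :
    (j.val < i.val ∧ (SimplexCategory.δ i j).val = j.val) ∨
      (i.val ≤ j.val ∧ (SimplexCategory.δ i j).val = j.val + 1) := by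
  have hδ : (SimplexCategory.δ i j).val = (i.succAbove j).val := rfl
  rw [hδ]
  rcases lt_or_ge j.castSucc i with h | h
  · exact Or.inl ⟨h, by rw [Fin.succAbove_of_castSucc_lt _ _ h]; rfl⟩
  · exact Or.inr ⟨h, by rw [Fin.succAbove_of_le_castSucc _ _ h]; rfl⟩

theorem subinterval_val {n : ℕ} (j l : ℕ) (h : j + l ≤ n) (i : Fin (l + 1)) :
    (SimplexCategory.subinterval j l h i).val = i.val + j := rfl

theorem coboundary_apply {n : ℕ} (a : Cochain X R n) (σ : SingularSimplex X (n + 1)) :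
    coboundary X R n a σ = ∑ i : Fin (n + 2), (-1 : R) ^ (i : ℕ) *
      a ((TopCat.toSSet.obj (TopCat.of X)).map (SimplexCategory.δ i).op σ) := rfl

/-- The Leibniz rule `d (a ⌣ b) = d a ⌣ b + (-1) ^ p a ⌣ d b`. -/
theorem coboundary_cochainCup {p q n : ℕ} (h : p + q = n) (a : Cochain X R p)
    (b : Cochain X R q) :
    coboundary X R n (cochainCup h a b) =
      cochainCup (by omega : (p + 1) + q = n + 1) (coboundary X R p a) b +
      (fun σ => (-1 : R) ^ p *
        cochainCup (by omega : p + (q + 1) = n + 1) a (coboundary X R q b) σ) := by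
  funext σ
  have e : (p + 1) + (q + 1) = n + 2 := by omega
  -- the faces of index at most `p`
  have h1 : ∀ i : Fin (p + 1),
      cochainCup h a b ((TopCat.toSSet.obj (TopCat.of X)).map
        (SimplexCategory.δ (Fin.cast e (Fin.castAdd (q + 1) i))).op σ) =
      a ((TopCat.toSSet.obj (TopCat.of X)).map (SimplexCategory.δ i.castSucc).op
        (subface 0 (p + 1) (by omega) σ)) * b (subface (p + 1) q (by omega) σ) := by
    intro i
    have hi := i.isLt
    unfold cochainCup subface
    congr 2
    · apply map_map_eq
      intro j
      have A := δ_val (Fin.cast e (Fin.castAdd (q + 1) i))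
        (SimplexCategory.subinterval 0 p (by omega) j)
      have B := δ_val i.castSucc j
      rw [subinterval_val] at A ⊢
      simp only [Fin.val_cast, Fin.val_castAdd, Fin.val_castSucc] at A B
      omega
    · apply map_map_eq_single
      intro j
      have A := δ_val (Fin.cast e (Fin.castAdd (q + 1) i))
        (SimplexCategory.subinterval p q h.le j)
      rw [subinterval_val] at A ⊢
      simp only [Fin.val_cast, Fin.val_castAdd] at A
      omega
  -- the faces of index greater than `p`
  have h2 : ∀ i : Fin (q + 1),
      cochainCup h a b ((TopCat.toSSet.obj (TopCat.of X)).map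
        (SimplexCategory.δ (Fin.cast e (Fin.natAdd (p + 1) i))).op σ) =
      a (subface 0 p (by omega) σ) * b ((TopCat.toSSet.obj (TopCat.of X)).map
        (SimplexCategory.δ i.succ).op (subface p (q + 1) (by omega) σ)) := by
    intro i
    unfold cochainCup subface
    congr 2
    · apply map_map_eq_single
      intro j
      have hj : j.val < p + 1 := j.isLt
      have A := δ_val (Fin.cast e (Fin.natAdd (p + 1) i))
        (SimplexCategory.subinterval 0 p (by omega) j)
      rw [subinterval_val] at A ⊢
      simp only [Fin.val_cast, Fin.val_natAdd] at A
      omega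
    · apply map_map_eq
      intro j
      have A := δ_val (Fin.cast e (Fin.natAdd (p + 1) i))
        (SimplexCategory.subinterval p q h.le j)
      have B := δ_val i.succ j
      rw [subinterval_val] at A ⊢
      simp only [Fin.val_cast, Fin.val_natAdd, Fin.val_succ] at A B
      omega
  -- the two extra terms on the right-hand side
  have h3 : (TopCat.toSSet.obj (TopCat.of X)).map (SimplexCategory.δ (Fin.last (p + 1))).op
      (subface 0 (p + 1) (by omega) σ) = subface 0 p (by omega) σ := by
    apply map_map_eq_single
    intro j
    have hj : j.val < p + 1 := j.isLt
    have A := δ_val (Fin.last (p + 1)) j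
    rw [subinterval_val, subinterval_val]
    simp only [Fin.val_last] at A
    omega
  have h4 : (TopCat.toSSet.obj (TopCat.of X)).map (SimplexCategory.δ (0 : Fin (q + 2))).op
      (subface p (q + 1) (by omega) σ) = subface (p + 1) q (by omega) σ := by
    apply map_map_eq_single
    intro j
    have A := δ_val (0 : Fin (q + 2)) j
    rw [subinterval_val, subinterval_val]
    simp only [Fin.val_zero] at A
    omega
  have hc : ∀ x y : R, ∀ i : ℕ, x * ((-1) ^ i * y) = (-1) ^ i * (x * y) := by
    intro x y i
    rw [← mul_assoc, ← mul_assoc, ((Commute.neg_one_right x).pow_right i).eq]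
  rw [coboundary_apply, ← Equiv.sum_comp (finCongr e), Fin.sum_univ_add]
  simp only [finCongr_apply, h1, h2]
  show _ = coboundary X R p a (subface 0 (p + 1) _ σ) * b (subface (p + 1) q _ σ) +
    (-1 : R) ^ p * (a (subface 0 p _ σ) * coboundary X R q b (subface p (q + 1) _ σ))
  rw [coboundary_apply, coboundary_apply,
    Fin.sum_univ_castSucc (n := p + 1), Fin.sum_univ_succ (n := q + 1), h3, h4]
  rw [add_mul, Finset.sum_mul, mul_add, mul_add, Finset.mul_sum, Finset.mul_sum,
    add_assoc (Finset.sum _ _)]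
  congr 1
  · exact Finset.sum_congr rfl fun i _ => (mul_assoc _ _ _).symm
  · rw [← add_assoc ((-1 : R) ^ _ * _ * _)]
    have h0 : ∀ x : R, (-1 : R) ^ ((Fin.last (p + 1) : Fin (p + 2)) : ℕ) *
        a (subface 0 p (by omega) σ) * x +
        (-1 : R) ^ p * (a (subface 0 p (by omega) σ) *
          ((-1 : R) ^ ((0 : Fin (q + 2)) : ℕ) * x)) = 0 := by
      intro x
      rw [Fin.val_last, Fin.val_zero, pow_zero, one_mul, pow_succ, mul_neg_one, neg_mul, neg_mul,
        mul_assoc, neg_add_cancel]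
    rw [h0, zero_add (Finset.sum _ _)]
    refine Finset.sum_congr rfl fun i _ => ?_
    rw [hc, ← mul_assoc ((-1 : R) ^ p), ← pow_add]
    congr 2
    simp only [Fin.val_cast, Fin.val_natAdd, Fin.val_succ]
    omega

theorem cochainCup_mem_cocycles {p q n : ℕ} (h : p + q = n) {a : Cochain X R p}
    {b : Cochain X R q} (ha : a ∈ cocycles X R p) (hb : b ∈ cocycles X R q) :
    cochainCup h a b ∈ cocycles X R n := by
  have ha' : coboundary X R p a = 0 := ha
  have hb' : coboundary X R q b = 0 := hb
  show coboundary X R n (cochainCup h a b) = 0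
  rw [coboundary_cochainCup, ha', hb']
  funext σ
  simp [cochainCup]

theorem cochainCup_mem_coboundaries_left {p q n : ℕ} (h : p + q = n) {a : Cochain X R p}
    {b : Cochain X R q} (ha : a ∈ coboundaries X R p) (hb : b ∈ cocycles X R q) :
    cochainCup h a b ∈ coboundaries X R n := by
  have hb' : coboundary X R q b = 0 := hb
  cases p with
  | zero =>
    have h0 : a = 0 := ha
    have h1 : cochainCup h a b = 0 := by
      funext σ
      simp [cochainCup, h0]
    rw [h1]
    exact zero_mem _
  | succ p =>
    obtain ⟨c, rfl⟩ := ha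
    obtain ⟨m, rfl⟩ : ∃ m, n = m + 1 := ⟨p + q, by omega⟩
    refine ⟨cochainCup (by omega : p + q = m) c b, ?_⟩
    rw [coboundary_cochainCup, hb']
    funext σ
    simp [cochainCup]

theorem cochainCup_mem_coboundaries_right {p q n : ℕ} (h : p + q = n) {a : Cochain X R p}
    {b : Cochain X R q} (ha : a ∈ cocycles X R p) (hb : b ∈ coboundaries X R q) :
    cochainCup h a b ∈ coboundaries X R n := by
  have ha' : coboundary X R p a = 0 := ha
  cases q with
  | zero =>
    have h0 : b = 0 := hb
    have h1 : cochainCup h a b = 0 := by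
      funext σ
      simp [cochainCup, h0]
    rw [h1]
    exact zero_mem _
  | succ q =>
    obtain ⟨c, rfl⟩ := hb
    obtain ⟨m, rfl⟩ : ∃ m, n = m + 1 := ⟨p + q, by omega⟩
    refine ⟨cochainCup (by omega : p + q = m) (fun σ => (-1 : R) ^ p * a σ) c, ?_⟩
    have hd : coboundary X R p (fun σ => (-1 : R) ^ p * a σ) = 0 := by
      funext σ
      have hσ : coboundary X R p a σ = 0 := by rw [ha']; rfl
      rw [coboundary_apply] at hσ ⊢
      simp only [← mul_assoc, ← pow_add, add_comm _ p]
      simp only [pow_add, mul_assoc, ← Finset.mul_sum]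
      rw [hσ, mul_zero]
      rfl
    rw [coboundary_cochainCup, hd]
    funext σ
    simp only [cochainCup, Pi.add_apply, Pi.zero_apply, zero_mul, zero_add, ← mul_assoc,
      ← pow_add, ← two_mul, pow_mul, neg_one_sq, one_pow, one_mul]

/-- The cup product `Hᵖ(X; R) × H^q(X; R) → Hⁿ(X; R)`, where `n = p + q`. -/
def cup {p q n : ℕ} (h : p + q = n) : Cohomology X R p → Cohomology X R q → Cohomology X R n :=
  Quotient.map₂
    (fun a b => (⟨cochainCup h a.1 b.1, cochainCup_mem_cocycles h a.2 b.2⟩ : cocycles X R n))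
    (by
      intro a a' ha b b' hb
      have ha₁ : (-a + a' : Cochain X R p) ∈ coboundaries X R p := by
        have := QuotientAddGroup.leftRel_apply.mp ha
        rwa [AddSubgroup.mem_addSubgroupOf] at this
      have hb₁ : (-b + b' : Cochain X R q) ∈ coboundaries X R q := by
        have := QuotientAddGroup.leftRel_apply.mp hb
        rwa [AddSubgroup.mem_addSubgroupOf] at this
      refine QuotientAddGroup.leftRel_apply.mpr ?_
      rw [AddSubgroup.mem_addSubgroupOf]
      have key : -cochainCup h a.1 b.1 + cochainCup h a'.1 b'.1 =
          cochainCup h (-a + a' : Cochain X R p) b'.1 +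
          cochainCup h a.1 (-b + b' : Cochain X R q) := by
        funext σ
        simp only [cochainCup, Pi.add_apply, Pi.neg_apply, add_mul, mul_add, neg_mul, mul_neg]
        abel
      show -cochainCup h a.1 b.1 + cochainCup h a'.1 b'.1 ∈ coboundaries X R n
      rw [key]
      exact add_mem (cochainCup_mem_coboundaries_left h ha₁ b'.2)
        (cochainCup_mem_coboundaries_right h a.2 hb₁))

variable (X R) in
/-- The unit `1 ∈ H⁰(X; R)`: the class of the constant `0`-cochain `1`. -/
def cohomologyOne {n : ℕ} (h : n = 0) : Cohomology X R n :=
  QuotientAddGroup.mk ⟨fun _ => 1, by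
    subst h
    show coboundary X R 0 (fun _ => 1) = 0
    funext σ
    simp [coboundary_apply, Fin.sum_univ_two]⟩

/-- The iterated cup product `β₁ ⌣ (β₂ ⌣ (⋯ ⌣ (βₙ ⌣ 1)))`, of degree `m = k₁ + ⋯ + kₙ`. -/
def iteratedCup : {n m : ℕ} → (k : Fin n → ℕ) → (∑ i, k i = m) →
    ((i : Fin n) → Cohomology X R (k i)) → Cohomology X R m
  | 0, _, _, h, _ => cohomologyOne X R (by simpa using h.symm)
  | _ + 1, _, k, h, β =>
    cup ((Fin.sum_univ_succ k).symm.trans h) (β 0)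
      (iteratedCup (fun i => k i.succ) rfl (fun i => β i.succ))

end Cup

/-! ### Absolute neighbourhood retracts and symmetric powers -/

/-- `X` is a metric ANR: it is metrizable, and whenever it is embedded as a closed subset of a
metrizable space `Z`, it is a retract of an open neighbourhood in `Z`. -/
def IsANR (X : Type u) [TopologicalSpace X] : Prop :=
  TopologicalSpace.MetrizableSpace X ∧
    ∀ (Z : Type u) [TopologicalSpace Z] [TopologicalSpace.MetrizableSpace Z] (e : X → Z),
      Topology.IsClosedEmbedding e →
        ∃ U : Set Z, IsOpen U ∧ Set.range e ⊆ U ∧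
          ∃ r : Z → X, ContinuousOn r U ∧ ∀ x, r (e x) = x

/-- Two `m`-tuples are related when they are in the same orbit of the symmetric group. -/
def permSetoid (m : ℕ) (X : Type u) : Setoid (Fin m → X) where
  r x y := ∃ σ : Equiv.Perm (Fin m), y = x ∘ σ
  iseqv :=
    { refl := fun x => ⟨1, rfl⟩
      symm := by
        rintro x _ ⟨σ, rfl⟩
        exact ⟨σ⁻¹, by funext i; simp⟩
      trans := by
        rintro x _ _ ⟨σ, rfl⟩ ⟨τ, rfl⟩
        exact ⟨σ * τ, rfl⟩ }

/-- The symmetric power `SP^m(X)`, the orbit space of `X^m` under permutation of coordinates. -/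
def SymPower (m : ℕ) (X : Type u) : Type u := Quotient (permSetoid m X)

instance (m : ℕ) (X : Type u) [TopologicalSpace X] : TopologicalSpace (SymPower m X) :=
  inferInstanceAs (TopologicalSpace (Quotient (permSetoid m X)))

/-- The diagonal inclusion `X → SP^m(X)`, `x ↦ [x, …, x]`. -/
def symDiag (m : ℕ) (X : Type u) [TopologicalSpace X] : C(X, SymPower m X) where
  toFun x := Quotient.mk (permSetoid m X) (fun _ => x)
  continuous_toFun := continuous_quotient_mk'.comp (continuous_pi fun _ => continuous_id)

/-- The diagonal map `Δ : X → X × X`. -/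
def diag (X : Type u) [TopologicalSpace X] : C(X, X × X) where
  toFun x := (x, x)
  continuous_toFun := continuous_id.prodMk continuous_id

/-! ### Distributional topological complexity -/

section DTC

variable (X : Type u) [MetricSpace X]

/-- The space of paths in `X`, with the metric of uniform convergence (hence the compact-open
topology). -/
abbrev PathSpace : Type u := C(unitInterval, X)

instance : MeasurableSpace (PathSpace X) := borel _

instance : BorelSpace (PathSpace X) := ⟨rfl⟩

variable {X}

/-- For `A ⊆ Z`, the set `ℬ_k(A)` of probability measures on `Z` that are supported by at most `k`
points, all of them in `A`; it lies in the space of all Borel probability measures on `Z` with the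
Lévy–Prokhorov metric. -/
def finSupported {Z : Type u} [MeasurableSpace Z] (k : ℕ) (A : Set Z) :
    Set (LevyProkhorov (ProbabilityMeasure Z)) :=
  {μ | ∃ F : Finset Z, F.card ≤ k ∧ (F : Set Z) ⊆ A ∧
    (μ.toMeasure : Measure Z) (F : Set Z)ᶜ = 0}

/-- The paths in `X` from `x` to `y`. -/
def pathsBetween (x y : X) : Set (PathSpace X) := {φ | φ 0 = x ∧ φ 1 = y}

variable (X)

/-- A `k`-distributed navigation algorithm: a continuous map `s : X × X → ℬ_k(P(X))` such that
`s (x, y) ∈ ℬ_k(P(x, y))` for all `x, y`. -/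
def IsNavigationAlgorithm (k : ℕ) (s : X × X → LevyProkhorov (ProbabilityMeasure (PathSpace X))) :
    Prop :=
  Continuous s ∧ ∀ x y : X, s (x, y) ∈ finSupported k (pathsBetween x y)

/-- The distributional topological complexity: the least `n` such that there is an
`(n + 1)`-distributed navigation algorithm on `X` (and `⊤` if there is no such `n`). -/
def dTC : ℕ∞ :=
  sInf {N : ℕ∞ | ∃ n : ℕ, N = n ∧ ∃ s, IsNavigationAlgorithm X (n + 1) s}

end DTC

end DistTC

end

noncomputable section

namespace DistTC

/-! Suppose that s is an (m+1)-distributed navigation algorithm with m + 1 ≤ n. Each measure s(x,y)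
has between 1 and n atoms, all of them paths from x to y. Under a small change of (x,y) atoms cannot
disappear, although new ones may be born with small mass (`eventually_atoms_close`). Hence on the
stratum A_i of pairs with exactly i atoms, the atoms form a continuous family of unordered i-tuples
of paths (`exists_branches`).

The ANR property extends this family, up to homotopy, to an open neighbourhood U_i of A_i. Place X
in a convex subset of a normed space, average matched paths with a partition of unity, and retract
the averages to X. Along the averaged paths the first coordinate of (x,y) is dragged towards y.
There are i paths and no consistent ordering of them, so the deformation exists not in X × X but in
SP^i(X × X), and after repeating entries in SP^m(X × X) for every multiple m of i. The choice m = n!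
serves all i ≤ n at once. The outcome is that δ composed with U_i ⊆ X × X is homotopic to δ ∘ Δ ∘
pr₂, so a zero-divisor that comes from SP^{n!} restricts to zero on U_i
(`Branches.pullback_nbhd_eq_zero`).

The open sets U_1, …, U_n cover X × X and β_i vanishes on U_i. The usual cup-length argument makes
the product zero (`iteratedCup_eq_zero`): each class has a cocycle that vanishes on the simplices in
U_i, the product cocycle vanishes on all simplices subordinate to the cover, and barycentric
subdivision shows that such a cocycle of positive degree is a coboundary
(`mem_range_coboundary_of_vanishes_on_cover`). Homotopy invariance and subdivision are derived from
identities between formal chains of vertex tuples, evaluated on affine simplices. -/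

/-! ### Chains of ordered tuples -/

section OrderedChains

variable {K K' : Type*}

/-- The augmented chain group of ordered `n`-tuples of points of `K`. -/
abbrev TupleChain (K : Type*) (n : ℕ) : Type _ := FreeAbelianGroup (Fin n → K)

/-- The map on tuple chains induced by a map of points. -/
def tupleMap (f : K → K') (n : ℕ) : TupleChain K n →+ TupleChain K' n :=
  FreeAbelianGroup.map fun v => f ∘ v

/-- The boundary of a tuple: the alternating sum of its faces. -/
def tupleBoundary (n : ℕ) : TupleChain K (n + 1) →+ TupleChain K n :=
  FreeAbelianGroup.lift fun v =>
    ∑ i : Fin (n + 1), (-1 : ℤ) ^ (i : ℕ) • FreeAbelianGroup.of (v ∘ i.succAbove)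

/-- The cone with apex `b`. -/
def tupleCone (b : K) (n : ℕ) : TupleChain K n →+ TupleChain K (n + 1) :=
  FreeAbelianGroup.map fun v => Fin.cons b v

@[simp] theorem tupleMap_of (f : K → K') {n : ℕ} (v : Fin n → K) :
    tupleMap f n (.of v) = .of (f ∘ v) := FreeAbelianGroup.map_of_apply _

@[simp] theorem tupleCone_of (b : K) {n : ℕ} (v : Fin n → K) :
    tupleCone b n (.of v) = .of (Fin.cons b v) := FreeAbelianGroup.map_of_apply _

theorem tupleBoundary_of {n : ℕ} (v : Fin (n + 1) → K) :
    tupleBoundary n (.of v) =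
      ∑ i : Fin (n + 1), (-1 : ℤ) ^ (i : ℕ) • FreeAbelianGroup.of (v ∘ i.succAbove) :=
  FreeAbelianGroup.lift_apply_of _ _

theorem tupleMap_tupleCone (f : K → K') (b : K) (n : ℕ) (c : TupleChain K n) :
    tupleMap f (n + 1) (tupleCone b n c) = tupleCone (f b) n (tupleMap f n c) := by
  suffices h : (tupleMap f (n + 1)).comp (tupleCone b n) =
      (tupleCone (f b) n).comp (tupleMap f n) from DFunLike.congr_fun h c
  ext v
  simp only [AddMonoidHom.comp_apply, tupleCone_of, tupleMap_of]
  congr 1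
  funext i
  refine Fin.cases ?_ (fun j => ?_) i <;> simp

theorem tupleMap_tupleBoundary (f : K → K') (n : ℕ) (c : TupleChain K (n + 1)) :
    tupleMap f n (tupleBoundary n c) = tupleBoundary n (tupleMap f (n + 1) c) := by
  suffices h : (tupleMap f n).comp (tupleBoundary n) =
      (tupleBoundary n).comp (tupleMap f (n + 1)) from DFunLike.congr_fun h c
  ext v
  simp only [AddMonoidHom.comp_apply, tupleBoundary_of, tupleMap_of, map_sum, map_zsmul]
  rfl

/-- Face 0 deletes the apex and every other face keeps it, with its index, and hence its sign,
shifted by one. All later chain identities are inductions on this formula. -/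
theorem tupleBoundary_tupleCone (b : K) (n : ℕ) (c : TupleChain K (n + 1)) :
    tupleBoundary (n + 1) (tupleCone b (n + 1) c) = c - tupleCone b n (tupleBoundary n c) := by
  suffices h : (tupleBoundary (n + 1)).comp (tupleCone b (n + 1)) =
      AddMonoidHom.id _ - (tupleCone b n).comp (tupleBoundary n) from DFunLike.congr_fun h c
  ext v
  simp only [AddMonoidHom.comp_apply, AddMonoidHom.sub_apply, AddMonoidHom.id_apply,
    tupleBoundary_of, tupleCone_of, map_sum, map_zsmul]
  rw [Fin.sum_univ_succ, sub_eq_add_neg, ← Finset.sum_neg_distrib]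
  refine congrArg₂ (· + ·) ?_ (Finset.sum_congr rfl fun i _ => ?_)
  · rw [Fin.val_zero, pow_zero, one_smul]
    congr 1
  · rw [Fin.val_succ, pow_succ, mul_neg_one, neg_smul]
    congr 3
    funext j
    refine Fin.cases ?_ (fun k => ?_) j <;> simp

theorem tupleBoundary_tupleCone_zero (b : K) (c : TupleChain K 0) :
    tupleBoundary 0 (tupleCone b 0 c) = c := by
  suffices h : (tupleBoundary 0).comp (tupleCone b 0) = AddMonoidHom.id _ from
    DFunLike.congr_fun h c
  ext v
  simp only [AddMonoidHom.comp_apply, tupleBoundary_of, tupleCone_of]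
  simp

theorem of_eq_tupleCone {n : ℕ} (v : Fin (n + 1) → K) :
    FreeAbelianGroup.of v = tupleCone (v 0) n (.of (Fin.tail v)) := by
  rw [tupleCone_of, Fin.cons_self_tail]

/-- A tuple is the cone over its tail, so the cone formula gives an induction that avoids the double
sum of signs. -/
theorem tupleBoundary_tupleBoundary (n : ℕ) (c : TupleChain K (n + 2)) :
    tupleBoundary n (tupleBoundary (n + 1) c) = 0 := by
  suffices h : (tupleBoundary n).comp (tupleBoundary (n + 1)) =
      (0 : TupleChain K (n + 2) →+ TupleChain K n) from DFunLike.congr_fun h c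
  clear c
  induction n with
  | zero =>
    ext v
    rw [AddMonoidHom.comp_apply, of_eq_tupleCone, tupleBoundary_tupleCone, map_sub,
      tupleBoundary_tupleCone_zero, sub_self]
    rfl
  | succ n ih =>
    ext v
    have key := DFunLike.congr_fun ih (.of (Fin.tail v))
    rw [AddMonoidHom.comp_apply] at key ⊢
    rw [of_eq_tupleCone, tupleBoundary_tupleCone, map_sub, tupleBoundary_tupleCone, key]
    simp

/-! ### Subdivision -/

/-- Subdivision of tuple chains: the tuple `v` is replaced by the cone over its subdivided boundary
with apex `b v`. -/
def subdiv (b : ∀ n, (Fin (n + 1) → K) → K) : (n : ℕ) → TupleChain K n →+ TupleChain K n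
  | 0 => AddMonoidHom.id _
  | n + 1 => FreeAbelianGroup.lift fun v =>
      tupleCone (b n v) n (subdiv b n (tupleBoundary n (.of v)))

/-- The chain homotopy between the identity and the subdivision. -/
def subdivHomotopy (b : ∀ n, (Fin (n + 1) → K) → K) :
    (n : ℕ) → TupleChain K n →+ TupleChain K (n + 1)
  | 0 => 0
  | n + 1 => FreeAbelianGroup.lift fun v =>
      tupleCone (b n v) (n + 1) (.of v - subdivHomotopy b n (tupleBoundary n (.of v)))

theorem subdiv_succ_of (b : ∀ n, (Fin (n + 1) → K) → K) {n : ℕ} (v : Fin (n + 1) → K) :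
    subdiv b (n + 1) (.of v) = tupleCone (b n v) n (subdiv b n (tupleBoundary n (.of v))) :=
  FreeAbelianGroup.lift_apply_of _ _

theorem subdivHomotopy_succ_of (b : ∀ n, (Fin (n + 1) → K) → K) {n : ℕ} (v : Fin (n + 1) → K) :
    subdivHomotopy b (n + 1) (.of v) =
      tupleCone (b n v) (n + 1) (.of v - subdivHomotopy b n (tupleBoundary n (.of v))) :=
  FreeAbelianGroup.lift_apply_of _ _

theorem tupleBoundary_subdiv (b : ∀ n, (Fin (n + 1) → K) → K) (n : ℕ) (c : TupleChain K (n + 1)) :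
    tupleBoundary n (subdiv b (n + 1) c) = subdiv b n (tupleBoundary n c) := by
  suffices h : (tupleBoundary n).comp (subdiv b (n + 1)) =
      (subdiv b n).comp (tupleBoundary n) from DFunLike.congr_fun h c
  clear c
  induction n with
  | zero =>
    ext v
    simp only [AddMonoidHom.comp_apply]
    rw [subdiv_succ_of, tupleBoundary_tupleCone_zero]
  | succ n ih =>
    ext v
    simp only [AddMonoidHom.comp_apply]
    rw [subdiv_succ_of, tupleBoundary_tupleCone,
      ← AddMonoidHom.comp_apply (tupleBoundary n), ih, AddMonoidHom.comp_apply,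
      tupleBoundary_tupleBoundary, map_zero, map_zero, sub_zero]

/-- With S the subdivision and T the homotopy, the chain v - T∂v has boundary S∂v by induction and
∂∂ = 0. Coning it off from the apex therefore produces v - T∂v - Sv. -/
theorem subdivHomotopy_spec (b : ∀ n, (Fin (n + 1) → K) → K) (n : ℕ) (c : TupleChain K (n + 1)) :
    tupleBoundary (n + 1) (subdivHomotopy b (n + 1) c) + subdivHomotopy b n (tupleBoundary n c) =
      c - subdiv b (n + 1) c := by
  suffices h : (tupleBoundary (n + 1)).comp (subdivHomotopy b (n + 1)) +
      (subdivHomotopy b n).comp (tupleBoundary n) =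
      AddMonoidHom.id _ - subdiv b (n + 1) from DFunLike.congr_fun h c
  clear c
  induction n with
  | zero =>
    ext v
    simp only [AddMonoidHom.comp_apply, AddMonoidHom.add_apply, AddMonoidHom.sub_apply,
      AddMonoidHom.id_apply]
    rw [subdivHomotopy_succ_of, tupleBoundary_tupleCone, subdiv_succ_of]
    simp [subdivHomotopy, subdiv]
  | succ n ih =>
    ext v
    have key := DFunLike.congr_fun ih (tupleBoundary (n + 1) (.of v))
    simp only [AddMonoidHom.comp_apply, AddMonoidHom.add_apply, AddMonoidHom.sub_apply,
      AddMonoidHom.id_apply, tupleBoundary_tupleBoundary, map_zero, add_zero] at key ⊢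
    rw [subdivHomotopy_succ_of, tupleBoundary_tupleCone, subdiv_succ_of, map_sub, key,
      sub_sub_cancel]
    abel

/-- Affine maps satisfy the hypothesis for barycentres. This compares the subdivision of a face with
that of the whole simplex. -/
theorem tupleMap_subdiv {b : ∀ n, (Fin (n + 1) → K) → K} {b' : ∀ n, (Fin (n + 1) → K') → K'}
    {f : K → K'} (hf : ∀ n v, f (b n v) = b' n (f ∘ v)) (n : ℕ) (c : TupleChain K n) :
    tupleMap f n (subdiv b n c) = subdiv b' n (tupleMap f n c) := by
  suffices h : (tupleMap f n).comp (subdiv b n) = (subdiv b' n).comp (tupleMap f n) from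
    DFunLike.congr_fun h c
  clear c
  induction n with
  | zero => rfl
  | succ n ih =>
    ext v
    have key := DFunLike.congr_fun ih (tupleBoundary n (.of v))
    simp only [AddMonoidHom.comp_apply] at key ⊢
    rw [subdiv_succ_of, tupleMap_tupleCone, key, tupleMap_of, subdiv_succ_of, hf,
      tupleMap_tupleBoundary, tupleMap_of]

theorem tupleMap_subdivHomotopy {b : ∀ n, (Fin (n + 1) → K) → K}
    {b' : ∀ n, (Fin (n + 1) → K') → K'} {f : K → K'} (hf : ∀ n v, f (b n v) = b' n (f ∘ v)) (n : ℕ)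
    (c : TupleChain K n) :
    tupleMap f (n + 1) (subdivHomotopy b n c) = subdivHomotopy b' n (tupleMap f n c) := by
  suffices h : (tupleMap f (n + 1)).comp (subdivHomotopy b n) =
      (subdivHomotopy b' n).comp (tupleMap f n) from DFunLike.congr_fun h c
  clear c
  induction n with
  | zero => simp [subdivHomotopy]
  | succ n ih =>
    ext v
    have key := DFunLike.congr_fun ih (tupleBoundary n (.of v))
    simp only [AddMonoidHom.comp_apply] at key ⊢
    rw [subdivHomotopy_succ_of, tupleMap_tupleCone, map_sub, key, tupleMap_of,
      subdivHomotopy_succ_of, hf, tupleMap_tupleBoundary, tupleMap_of]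

/-! ### Prisms -/

/-- The prism between two copies `i₀ v` and `i₁ v` of a tuple `v`. -/
def prism (i₀ i₁ : K → K') : (n : ℕ) → TupleChain K n →+ TupleChain K' (n + 1)
  | 0 => 0
  | n + 1 => FreeAbelianGroup.lift fun v =>
      tupleCone (i₀ (v 0)) (n + 1) (.of (i₁ ∘ v) - prism i₀ i₁ n (.of (Fin.tail v)))

theorem prism_succ_of (i₀ i₁ : K → K') {n : ℕ} (v : Fin (n + 1) → K) :
    prism i₀ i₁ (n + 1) (.of v) =
      tupleCone (i₀ (v 0)) (n + 1) (.of (i₁ ∘ v) - prism i₀ i₁ n (.of (Fin.tail v))) :=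
  FreeAbelianGroup.lift_apply_of _ _

theorem prism_tupleCone (i₀ i₁ : K → K') (x : K) (n : ℕ) (c : TupleChain K n) :
    prism i₀ i₁ (n + 1) (tupleCone x n c) = tupleCone (i₀ x) (n + 1)
      (tupleCone (i₁ x) n (tupleMap i₁ n c) - prism i₀ i₁ n c) := by
  suffices h : (prism i₀ i₁ (n + 1)).comp (tupleCone x n) = (tupleCone (i₀ x) (n + 1)).comp
      ((tupleCone (i₁ x) n).comp (tupleMap i₁ n) - prism i₀ i₁ n) from DFunLike.congr_fun h c
  ext v
  simp only [AddMonoidHom.comp_apply, AddMonoidHom.sub_apply]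
  rw [tupleCone_of, prism_succ_of, ← tupleMap_tupleCone, tupleCone_of, tupleMap_of]
  simp

/-- Writing a tuple as a cone over its tail turns the recursion for the prism into
`prism_tupleCone`; the cone formula then reduces the identity to the tail. -/
theorem prism_spec (i₀ i₁ : K → K') (n : ℕ) (c : TupleChain K (n + 1)) :
    tupleBoundary (n + 1) (prism i₀ i₁ (n + 1) c) + prism i₀ i₁ n (tupleBoundary n c) =
      tupleMap i₁ (n + 1) c - tupleMap i₀ (n + 1) c := by
  suffices h : (tupleBoundary (n + 1)).comp (prism i₀ i₁ (n + 1)) +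
      (prism i₀ i₁ n).comp (tupleBoundary n) = tupleMap i₁ (n + 1) - tupleMap i₀ (n + 1) from
    DFunLike.congr_fun h c
  clear c
  induction n with
  | zero =>
    ext v
    simp only [AddMonoidHom.comp_apply, AddMonoidHom.add_apply, AddMonoidHom.sub_apply]
    rw [of_eq_tupleCone, prism_tupleCone, tupleBoundary_tupleCone, map_sub,
      tupleBoundary_tupleCone_zero, tupleMap_tupleCone, tupleMap_tupleCone]
    simp only [prism, AddMonoidHom.zero_apply, sub_zero, map_zero, add_zero, tupleMap_of]
    -- Both are the empty tuple, the generator in augmentation degree.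
    rw [Subsingleton.elim (i₁ ∘ Fin.tail v) (i₀ ∘ Fin.tail v)]
  | succ n ih =>
    ext v
    set w := FreeAbelianGroup.of (Fin.tail v) with hw
    have key := DFunLike.congr_fun ih w
    simp only [AddMonoidHom.comp_apply, AddMonoidHom.add_apply, AddMonoidHom.sub_apply] at key ⊢
    rw [of_eq_tupleCone, ← hw, prism_tupleCone, tupleBoundary_tupleCone, map_sub (tupleBoundary _),
      tupleBoundary_tupleCone, tupleBoundary_tupleCone, map_sub (prism i₀ i₁ _), prism_tupleCone,
      eq_sub_of_add_eq key, tupleMap_tupleCone, tupleMap_tupleCone, tupleMap_tupleBoundary]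
    simp only [map_sub]
    abel

theorem tupleMap_prism {L L' : Type*} {i₀ i₁ : K → K'} {j₀ j₁ : L → L'} {f : K → L} {f' : K' → L'}
    (h₀ : ∀ x, f' (i₀ x) = j₀ (f x)) (h₁ : ∀ x, f' (i₁ x) = j₁ (f x)) (n : ℕ)
    (c : TupleChain K n) :
    tupleMap f' (n + 1) (prism i₀ i₁ n c) = prism j₀ j₁ n (tupleMap f n c) := by
  suffices h : (tupleMap f' (n + 1)).comp (prism i₀ i₁ n) =
      (prism j₀ j₁ n).comp (tupleMap f n) from DFunLike.congr_fun h c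
  clear c
  induction n with
  | zero => simp [prism]
  | succ n ih =>
    ext v
    have key := DFunLike.congr_fun ih (.of (Fin.tail v))
    simp only [AddMonoidHom.comp_apply] at key ⊢
    have hv : f' ∘ i₁ ∘ v = j₁ ∘ f ∘ v := funext fun x => h₁ _
    rw [prism_succ_of, tupleMap_tupleCone, map_sub, key, tupleMap_of, tupleMap_of, tupleMap_of,
      prism_succ_of, h₀, hv]
    rfl

end OrderedChains

/-! ### Affine simplices -/

section Affine

variable {E F : Type*} [AddCommGroup E] [Module ℝ E] [TopologicalSpace E]
  [IsTopologicalAddGroup E] [ContinuousSMul ℝ E]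
  [AddCommGroup F] [Module ℝ F] [TopologicalSpace F] [IsTopologicalAddGroup F] [ContinuousSMul ℝ F]
  {S : Set E} {T : Set F}

/-- The affine simplex in the convex set `S` with the given vertices. -/
def affineSimplex (hS : Convex ℝ S) {n : ℕ} (v : Fin (n + 1) → S) :
    C(stdSimplex ℝ (Fin (n + 1)), S) where
  toFun t := ⟨∑ i, t i • (v i : E),
    hS.sum_mem (fun i _ => t.2.1 i) t.2.2 fun i _ => (v i).2⟩
  continuous_toFun := by
    refine Continuous.subtype_mk (continuous_finsetSum _ fun i _ => ?_) _
    exact ((continuous_apply i).comp continuous_subtype_val).smul continuous_const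

theorem affineSimplex_coe (hS : Convex ℝ S) {n : ℕ} (v : Fin (n + 1) → S)
    (t : stdSimplex ℝ (Fin (n + 1))) :
    (affineSimplex hS v t : E) = ∑ i, t i • (v i : E) := rfl

theorem affineSimplex_map (hS : Convex ℝ S) {m n : ℕ} (v : Fin (n + 1) → S)
    (φ : Fin (m + 1) → Fin (n + 1)) (t : stdSimplex ℝ (Fin (m + 1))) :
    affineSimplex hS v (stdSimplex.map φ t) = affineSimplex hS (v ∘ φ) t := by
  refine Subtype.ext ?_
  rw [affineSimplex_coe, affineSimplex_coe]
  simp only [stdSimplex.map_coe, FunOnFinite.linearMap_apply_apply, Finset.sum_smul]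
  rw [← Finset.sum_fiberwise Finset.univ φ (fun i => t i • (((v ∘ φ) i : S) : E))]
  refine Finset.sum_congr rfl fun j _ => Finset.sum_congr rfl fun i hi => ?_
  rw [Function.comp_apply, (Finset.mem_filter.mp hi).2]

/-- The vertices of the standard simplex. -/
def stdVertices (n : ℕ) : Fin (n + 1) → stdSimplex ℝ (Fin (n + 1)) :=
  fun i => ⟨Pi.single i 1, single_mem_stdSimplex ℝ i⟩

theorem affineSimplex_stdVertices (hS : Convex ℝ S) {n : ℕ} (v : Fin (n + 1) → S)
    (i : Fin (n + 1)) : affineSimplex hS v (stdVertices n i) = v i := by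
  refine Subtype.ext ?_
  rw [affineSimplex_coe, Finset.sum_eq_single i]
  · change (Pi.single i (1 : ℝ) : Fin (n + 1) → ℝ) i • (v i : E) = _
    rw [Pi.single_eq_same, one_smul]
  · intro j _ hj
    change (Pi.single i (1 : ℝ) : Fin (n + 1) → ℝ) j • (v j : E) = _
    rw [Pi.single_eq_of_ne hj, zero_smul]
  · simp

theorem affineSimplex_stdVertices_id (n : ℕ) (t : stdSimplex ℝ (Fin (n + 1))) :
    affineSimplex (convex_stdSimplex ℝ (Fin (n + 1))) (stdVertices n) t = t := by
  refine Subtype.ext ?_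
  rw [affineSimplex_coe]
  funext j
  rw [Finset.sum_apply, Finset.sum_eq_single j]
  · change t j • (Pi.single j (1 : ℝ) : Fin (n + 1) → ℝ) j = _
    rw [Pi.single_eq_same, smul_eq_mul, mul_one]
    rfl
  · intro i _ hi
    change t i • (Pi.single i (1 : ℝ) : Fin (n + 1) → ℝ) j = _
    rw [Pi.single_eq_of_ne hi.symm, smul_zero]
  · simp

/-- A map between convex sets is affine if it preserves affine simplices. -/
def PreservesAffine (hS : Convex ℝ S) (hT : Convex ℝ T) (h : C(S, T)) : Prop :=
  ∀ (n : ℕ) (v : Fin (n + 1) → S) (t : stdSimplex ℝ (Fin (n + 1))),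
    h (affineSimplex hS v t) = affineSimplex hT (h ∘ v) t

theorem preservesAffine_affineSimplex (hS : Convex ℝ S) {n : ℕ} (v : Fin (n + 1) → S) :
    PreservesAffine (convex_stdSimplex ℝ _) hS (affineSimplex hS v) := by
  intro m w t
  refine Subtype.ext ?_
  rw [affineSimplex_coe, affineSimplex_coe]
  simp only [Function.comp_apply, affineSimplex_coe, Finset.smul_sum, smul_smul]
  rw [Finset.sum_comm]
  refine Finset.sum_congr rfl fun i _ => ?_
  rw [← Finset.sum_smul]
  congr 1
  have h := congrFun (affineSimplex_coe (convex_stdSimplex ℝ (Fin (n + 1))) w t) i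
  rw [Finset.sum_apply] at h
  exact h

/-- The barycentre of the standard simplex. -/
def stdBarycenter (n : ℕ) : stdSimplex ℝ (Fin (n + 1)) :=
  ⟨fun _ => ((n : ℝ) + 1)⁻¹, fun _ => by positivity, by
    have : (n : ℝ) + 1 ≠ 0 := by positivity
    simp [this]⟩

/-- The barycentre of a tuple of points in a convex set. -/
def barycenter (hS : Convex ℝ S) (n : ℕ) (v : Fin (n + 1) → S) : S :=
  affineSimplex hS v (stdBarycenter n)

theorem barycenter_coe (hS : Convex ℝ S) (n : ℕ) (v : Fin (n + 1) → S) :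
    (barycenter hS n v : E) = ∑ i, ((n : ℝ) + 1)⁻¹ • (v i : E) := rfl

end Affine

/-! ### Mesh of the barycentric subdivision -/

section Mesh

variable {K : Type*}

/-- The tuple chains supported by tuples with the property `p`. -/
def chainsOn {n : ℕ} (p : (Fin n → K) → Prop) : AddSubgroup (TupleChain K n) :=
  AddSubgroup.closure (FreeAbelianGroup.of '' {v | p v})

theorem of_mem_chainsOn {n : ℕ} {p : (Fin n → K) → Prop} {v : Fin n → K} (h : p v) :
    FreeAbelianGroup.of v ∈ chainsOn p :=
  AddSubgroup.subset_closure ⟨v, h, rfl⟩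

theorem mem_of_mem_chainsOn {G : Type*} [AddCommGroup G] {n : ℕ} {p : (Fin n → K) → Prop}
    (f : TupleChain K n →+ G) (H : AddSubgroup G) (hf : ∀ v, p v → f (.of v) ∈ H)
    {c : TupleChain K n} (hc : c ∈ chainsOn p) : f c ∈ H := by
  have : chainsOn p ≤ H.comap f := by
    rw [chainsOn, AddSubgroup.closure_le]
    rintro _ ⟨v, hv, rfl⟩
    exact hf v hv
  exact this hc

theorem mem_chainsOn_true {n : ℕ} {p : (Fin n → K) → Prop} (hp : ∀ v, p v) (c : TupleChain K n) :
    c ∈ chainsOn p := by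
  induction c using FreeAbelianGroup.induction_on with
  | zero => exact zero_mem _
  | of v => exact of_mem_chainsOn (hp v)
  | neg v => exact neg_mem (of_mem_chainsOn (hp v))
  | add x y hx hy => exact add_mem hx hy

variable {E : Type*} [NormedAddCommGroup E] [NormedSpace ℝ E] {S : Set E}

/-- The difference is the mean of the n + 1 vectors v i - v j, one of which is zero. -/
theorem dist_barycenter_le (hS : Convex ℝ S) {n : ℕ} (v : Fin (n + 1) → S) {d : ℝ}
    (hd : ∀ i j, dist (v i) (v j) ≤ d) (i : Fin (n + 1)) :
    dist (v i : E) (barycenter hS n v) ≤ n / (n + 1) * d := by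
  have hn : (n : ℝ) + 1 ≠ 0 := by positivity
  have h1 : (v i : E) - barycenter hS n v =
      ∑ j ∈ Finset.univ.erase i, ((n : ℝ) + 1)⁻¹ • ((v i : E) - v j) := by
    rw [Finset.sum_erase _ (by simp), barycenter_coe]
    simp only [smul_sub, Finset.sum_sub_distrib, Finset.sum_const, Finset.card_univ,
      Fintype.card_fin]
    rw [← Nat.cast_smul_eq_nsmul ℝ, smul_smul]
    push_cast
    rw [mul_inv_cancel₀ hn, one_smul]
  rw [dist_eq_norm, h1]
  refine (norm_sum_le _ _).trans ?_
  have h2 : ∀ j ∈ Finset.univ.erase i,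
      ‖((n : ℝ) + 1)⁻¹ • ((v i : E) - v j)‖ ≤ ((n : ℝ) + 1)⁻¹ * d := by
    intro j _
    rw [norm_smul, norm_inv, Real.norm_of_nonneg (by positivity : (0 : ℝ) ≤ n + 1), ← dist_eq_norm]
    exact mul_le_mul_of_nonneg_left (hd i j) (by positivity)
  refine (Finset.sum_le_sum h2).trans ?_
  rw [Finset.sum_const, Finset.card_erase_of_mem (Finset.mem_univ _), Finset.card_univ,
    Fintype.card_fin, nsmul_eq_mul, Nat.add_sub_cancel]
  apply le_of_eq
  field_simp

/-- The ratio of the top dimension N dominates those of all faces, so one constant passes through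
the induction. The convex hull condition is carried along to control the distances from the new apex
to the vertices of the subdivided faces. -/
theorem subdiv_mem_chainsOn (hS : Convex ℝ S) (N : ℕ) {d : ℝ} (hd0 : 0 ≤ d) :
    ∀ (n : ℕ) (_ : n ≤ N + 1) (v : Fin n → S) (_ : ∀ i j, dist (v i) (v j) ≤ d),
    subdiv (barycenter hS) n (.of v) ∈ chainsOn (fun w : Fin n → S =>
      (∀ i, (w i : E) ∈ convexHull ℝ (Set.range fun j => (v j : E))) ∧
        ∀ i j, dist (w i) (w j) ≤ N / (N + 1) * d)
  | 0, _, v, _ => of_mem_chainsOn ⟨fun i => i.elim0, fun i => i.elim0⟩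
  | n + 1, hn, v, hd => by
    rw [subdiv_succ_of, tupleBoundary_of, map_sum, map_sum]
    refine sum_mem fun k _ => ?_
    rw [map_zsmul, map_zsmul]
    refine zsmul_mem ?_ _
    have ih := subdiv_mem_chainsOn hS N hd0 n (by omega) (v ∘ k.succAbove)
      (fun i j => hd _ _)
    have hq : (n : ℝ) / (n + 1) * d ≤ N / (N + 1) * d := by
      refine mul_le_mul_of_nonneg_right ?_ hd0
      rw [div_le_div_iff₀ (by positivity) (by positivity)]
      have : (n : ℝ) ≤ N := by exact_mod_cast Nat.le_of_succ_le_succ hn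
      nlinarith
    -- A ball is convex, so it suffices that it contains the vertices.
    have hball : convexHull ℝ (Set.range fun j => (v j : E)) ⊆
        Metric.closedBall (barycenter hS n v : E) (N / (N + 1) * d) := by
      refine convexHull_min ?_ (convex_closedBall _ _)
      rintro _ ⟨i, rfl⟩
      exact (dist_barycenter_le hS v hd i).trans hq
    have hsub : convexHull ℝ (Set.range fun j => ((v ∘ k.succAbove) j : E)) ⊆
        convexHull ℝ (Set.range fun j => (v j : E)) :=
      convexHull_mono (by rintro _ ⟨j, rfl⟩; exact ⟨k.succAbove j, rfl⟩)
    have hb : (barycenter hS n v : E) ∈ convexHull ℝ (Set.range fun j => (v j : E)) :=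
      (convex_convexHull ℝ _).sum_mem (fun i _ => (stdBarycenter n).2.1 i) (stdBarycenter n).2.2
        fun i _ => subset_convexHull ℝ _ ⟨i, rfl⟩
    refine mem_of_mem_chainsOn (tupleCone (barycenter hS n v) n) _ ?_ ih
    rintro w ⟨hw1, hw2⟩
    rw [tupleCone_of]
    refine of_mem_chainsOn ⟨fun i => ?_, fun i j => ?_⟩
    · refine Fin.cases ?_ (fun i => ?_) i
      · exact hb
      · exact hsub (hw1 i)
    · refine Fin.cases ?_ (fun i => ?_) i <;> refine Fin.cases ?_ (fun j => ?_) j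
      · simp only [Fin.cons_zero, dist_self]
        positivity
      · have := hball (hsub (hw1 j))
        rw [Fin.cons_zero, Fin.cons_succ, dist_comm]
        exact this
      · have := hball (hsub (hw1 i))
        rw [Fin.cons_zero, Fin.cons_succ]
        exact this
      · rw [Fin.cons_succ, Fin.cons_succ]
        exact hw2 i j

theorem iterate_subdiv_mem_chainsOn (hS : Convex ℝ S) {n : ℕ} {d : ℝ} (hd0 : 0 ≤ d)
    {c : TupleChain S (n + 1)}
    (hc : c ∈ chainsOn fun w : Fin (n + 1) → S => ∀ i j, dist (w i) (w j) ≤ d) (m : ℕ) :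
    (subdiv (barycenter hS) (n + 1))^[m] c ∈
      chainsOn fun w : Fin (n + 1) → S => ∀ i j, dist (w i) (w j) ≤ ((n : ℝ) / (n + 1)) ^ m * d := by
  induction m with
  | zero => simpa using hc
  | succ m ih =>
    rw [Function.iterate_succ_apply']
    refine mem_of_mem_chainsOn _ _ (fun v hv => ?_) ih
    have := subdiv_mem_chainsOn hS n (by positivity) (n + 1) le_rfl v hv
    refine AddSubgroup.closure_mono (Set.image_mono ?_) this
    rintro w ⟨_, hw⟩ i j
    rw [pow_succ', mul_assoc]
    exact hw i j

end Mesh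

/-! ### Singular simplices as continuous maps -/

section Simplices

variable {X Y : Type u} [TopologicalSpace X] [TopologicalSpace Y]

/-- Singular simplices are continuous maps on the standard simplex. -/
def simplexEquiv (X : Type u) [TopologicalSpace X] (n : ℕ) :
    SingularSimplex X n ≃ C(stdSimplex ℝ (Fin (n + 1)), X) :=
  TopCat.toSSetObjEquiv (TopCat.of X) (op (SimplexCategory.mk n))

theorem simplexEquiv_map_apply {m n : ℕ} (φ : SimplexCategory.mk m ⟶ SimplexCategory.mk n)
    (σ : SingularSimplex X n) (t : stdSimplex ℝ (Fin (m + 1))) :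
    simplexEquiv X m ((TopCat.toSSet.obj (TopCat.of X)).map φ.op σ) t =
      simplexEquiv X n σ (stdSimplex.map φ t) := rfl

theorem simplexEquiv_pushforward (f : C(X, Y)) {n : ℕ} (σ : SingularSimplex X n) :
    simplexEquiv Y n ((TopCat.toSSet.map (TopCat.ofHom f)).app _ σ) =
      f.comp (simplexEquiv X n σ) := rfl

end Simplices

/-! ### Evaluation of cochains on tuple chains -/

section Evaluation

variable {X Y : Type u} [TopologicalSpace X] [TopologicalSpace Y] {R : Type v} [Ring R]
  {E F : Type*} [AddCommGroup E] [Module ℝ E] [TopologicalSpace E]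
  [IsTopologicalAddGroup E] [ContinuousSMul ℝ E]
  [AddCommGroup F] [Module ℝ F] [TopologicalSpace F] [IsTopologicalAddGroup F] [ContinuousSMul ℝ F]
  {S : Set E} {T : Set F}

/-- The value of a cochain on the image under `g` of a chain of tuples in a convex set. -/
def evalChain (hS : Convex ℝ S) {n : ℕ} (a : Cochain X R n) (g : C(S, X)) :
    TupleChain S (n + 1) →+ R :=
  FreeAbelianGroup.lift fun v => a ((simplexEquiv X n).symm (g.comp (affineSimplex hS v)))

theorem evalChain_of (hS : Convex ℝ S) {n : ℕ} (a : Cochain X R n) (g : C(S, X))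
    (v : Fin (n + 1) → S) :
    evalChain hS a g (.of v) = a ((simplexEquiv X n).symm (g.comp (affineSimplex hS v))) :=
  FreeAbelianGroup.lift_apply_of _ _

theorem face_affineSimplex (hS : Convex ℝ S) {n : ℕ} (g : C(S, X)) (v : Fin (n + 2) → S)
    (i : Fin (n + 2)) :
    (TopCat.toSSet.obj (TopCat.of X)).map (SimplexCategory.δ i).op
      ((simplexEquiv X (n + 1)).symm (g.comp (affineSimplex hS v))) =
    (simplexEquiv X n).symm (g.comp (affineSimplex hS (v ∘ i.succAbove))) := by
  apply (simplexEquiv X n).injective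
  ext t
  rw [simplexEquiv_map_apply, Equiv.apply_symm_apply, Equiv.apply_symm_apply]
  exact congrArg g (affineSimplex_map hS v i.succAbove t)

theorem evalChain_coboundary (hS : Convex ℝ S) {n : ℕ} (a : Cochain X R n) (g : C(S, X))
    (c : TupleChain S (n + 2)) :
    evalChain hS (coboundary X R n a) g c = evalChain hS a g (tupleBoundary (n + 1) c) := by
  suffices h : evalChain hS (coboundary X R n a) g =
      (evalChain hS a g).comp (tupleBoundary (n + 1)) from DFunLike.congr_fun h c
  ext v
  simp only [AddMonoidHom.comp_apply]
  rw [evalChain_of, coboundary_apply, tupleBoundary_of, map_sum]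
  refine Finset.sum_congr rfl fun i _ => ?_
  rw [map_zsmul, evalChain_of, face_affineSimplex, zsmul_eq_mul]
  push_cast
  rfl

theorem evalChain_comp (hS : Convex ℝ S) (hT : Convex ℝ T) {n : ℕ} (a : Cochain X R n)
    (g : C(T, X)) {h : C(S, T)} (hh : PreservesAffine hS hT h) (c : TupleChain S (n + 1)) :
    evalChain hS a (g.comp h) c = evalChain hT a g (tupleMap h (n + 1) c) := by
  suffices H : evalChain hS a (g.comp h) = (evalChain hT a g).comp (tupleMap h (n + 1)) from
    DFunLike.congr_fun H c
  ext v
  simp only [AddMonoidHom.comp_apply]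
  rw [evalChain_of, tupleMap_of, evalChain_of]
  congr 2
  ext t
  exact congrArg g (hh n v t)

/-- The class of the identity simplex. -/
abbrev stdChain (n : ℕ) : TupleChain (stdSimplex ℝ (Fin (n + 1))) (n + 1) := .of (stdVertices n)

theorem evalChain_stdChain {n : ℕ} (a : Cochain X R n) (σ : SingularSimplex X n) :
    evalChain (convex_stdSimplex ℝ _) a (simplexEquiv X n σ) (stdChain n) = a σ := by
  rw [evalChain_of]
  congr 1
  rw [Equiv.symm_apply_eq]
  ext t
  exact congrArg (simplexEquiv X n σ) (affineSimplex_stdVertices_id n t)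

theorem tupleMap_stdChain (hS : Convex ℝ S) {n : ℕ} (v : Fin (n + 1) → S) :
    tupleMap (affineSimplex hS v) (n + 1) (stdChain n) = .of v := by
  rw [tupleMap_of]
  congr 1
  funext i
  exact affineSimplex_stdVertices hS v i

/-- Identities between cochains thereby reduce to identities between tuple chains in the standard
simplex. -/
theorem coboundary_eq_evalChain {n : ℕ} (a : Cochain X R n) (σ : SingularSimplex X (n + 1)) :
    coboundary X R n a σ = evalChain (convex_stdSimplex ℝ _) a (simplexEquiv X (n + 1) σ)
      (tupleBoundary (n + 1) (stdChain (n + 1))) := by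
  rw [← evalChain_coboundary, evalChain_stdChain]

theorem affineSimplex_barycenter (hS : Convex ℝ S) {m : ℕ} (u : Fin (m + 1) → S) (n : ℕ)
    (v : Fin (n + 1) → stdSimplex ℝ (Fin (m + 1))) :
    affineSimplex hS u (barycenter (convex_stdSimplex ℝ _) n v) =
      barycenter hS n (affineSimplex hS u ∘ v) :=
  preservesAffine_affineSimplex hS u n v _

end Evaluation

/-! ### Small simplices -/

section Small

variable {X : Type u} [TopologicalSpace X] {R : Type v} [Ring R]

/-- The barycentric subdivision of tuples in a standard simplex. -/
abbrev stdSubdiv (N n : ℕ) : TupleChain (stdSimplex ℝ (Fin (N + 1))) n →+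
    TupleChain (stdSimplex ℝ (Fin (N + 1))) n :=
  subdiv (barycenter (convex_stdSimplex ℝ (Fin (N + 1)))) n

/-- The chain homotopy of the barycentric subdivision of tuples in a standard simplex. -/
abbrev stdSubdivHomotopy (N n : ℕ) : TupleChain (stdSimplex ℝ (Fin (N + 1))) n →+
    TupleChain (stdSimplex ℝ (Fin (N + 1))) (n + 1) :=
  subdivHomotopy (barycenter (convex_stdSimplex ℝ (Fin (N + 1)))) n

/-- Evaluation of a cochain on `m`-fold subdivisions. -/
def evalSubdiv {N n : ℕ} (a : Cochain X R n) (σ : SingularSimplex X N) (m : ℕ) :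
    TupleChain (stdSimplex ℝ (Fin (N + 1))) (n + 1) →+ R where
  toFun c := evalChain (convex_stdSimplex ℝ _) a (simplexEquiv X N σ) ((stdSubdiv N (n + 1))^[m] c)
  map_zero' := by rw [iterate_map_zero, map_zero]
  map_add' c d := by rw [iterate_map_add, map_add]

theorem evalSubdiv_apply {N n : ℕ} (a : Cochain X R n) (σ : SingularSimplex X N) (m : ℕ)
    (c : TupleChain (stdSimplex ℝ (Fin (N + 1))) (n + 1)) :
    evalSubdiv a σ m c =
      evalChain (convex_stdSimplex ℝ _) a (simplexEquiv X N σ) ((stdSubdiv N (n + 1))^[m] c) := rfl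

theorem evalSubdiv_comp {M N n : ℕ} (a : Cochain X R n) (σ : SingularSimplex X N) (m : ℕ)
    (u : Fin (M + 1) → stdSimplex ℝ (Fin (N + 1)))
    (c : TupleChain (stdSimplex ℝ (Fin (M + 1))) (n + 1)) :
    evalSubdiv a ((simplexEquiv X M).symm
      ((simplexEquiv X N σ).comp (affineSimplex (convex_stdSimplex ℝ _) u))) m c =
    evalSubdiv a σ m (tupleMap (affineSimplex (convex_stdSimplex ℝ _) u) (n + 1) c) := by
  have h : ∀ d, tupleMap (affineSimplex (convex_stdSimplex ℝ _) u) (n + 1)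
      ((stdSubdiv M (n + 1))^[m] d) = (stdSubdiv N (n + 1))^[m]
        (tupleMap (affineSimplex (convex_stdSimplex ℝ _) u) (n + 1) d) := by
    intro d
    exact Function.Semiconj.iterate_right
      (fun d => tupleMap_subdiv (affineSimplex_barycenter (convex_stdSimplex ℝ _) u) _ d) m d
  rw [evalSubdiv_apply, evalSubdiv_apply, Equiv.apply_symm_apply,
    evalChain_comp _ (convex_stdSimplex ℝ _) _ _ (preservesAffine_affineSimplex _ u), h]

theorem evalSubdiv_tupleBoundary {N n : ℕ} {a : Cochain X R n} (ha : coboundary X R n a = 0)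
    (σ : SingularSimplex X N) (m : ℕ) (c : TupleChain (stdSimplex ℝ (Fin (N + 1))) (n + 2)) :
    evalSubdiv a σ m (tupleBoundary (n + 1) c) = 0 := by
  have h : ∀ d, tupleBoundary (n + 1) ((stdSubdiv N (n + 2))^[m] d) =
      (stdSubdiv N (n + 1))^[m] (tupleBoundary (n + 1) d) := fun d =>
    Function.Semiconj.iterate_right (fun d => tupleBoundary_subdiv _ _ d) m d
  rw [evalSubdiv_apply, ← h, ← evalChain_coboundary, ha]
  have h0 : evalChain (convex_stdSimplex ℝ _) (0 : Cochain X R (n + 1)) (simplexEquiv X N σ) = 0 := by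
    ext v
    rw [evalChain_of]
    rfl
  rw [h0, AddMonoidHom.zero_apply]

/-- Once the mesh is below a Lebesgue number of the pulled-back cover, every piece lies in one
member. The bound depends on σ but not on the chain, since all tuples in the standard simplex have
diameter at most 1. -/
theorem evalSubdiv_eventually_eq_zero {ι : Type*} {U : ι → Set X} (hU : ∀ i, IsOpen (U i))
    (hcov : ∀ x, ∃ i, x ∈ U i) {N n : ℕ} {a : Cochain X R n}
    (ha : ∀ i (τ : SingularSimplex X n), (∀ t, simplexEquiv X n τ t ∈ U i) → a τ = 0)
    (σ : SingularSimplex X N) :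
    ∃ M, ∀ m, M ≤ m → ∀ c, evalSubdiv a σ m c = 0 := by
  set g := simplexEquiv X N σ
  obtain ⟨δ, hδ, hball⟩ := lebesgue_number_lemma_of_metric (s := (Set.univ : Set (stdSimplex ℝ _)))
    (c := fun i => g ⁻¹' U i) isCompact_univ (fun i => (hU i).preimage g.continuous)
    (fun t _ => Set.mem_iUnion.mpr (hcov (g t)))
  have hq0 : (0 : ℝ) ≤ (n : ℝ) / (n + 1) := by positivity
  have hq1 : (n : ℝ) / (n + 1) < 1 := by
    rw [div_lt_one (by positivity)]
    linarith
  obtain ⟨M, hM⟩ := exists_pow_lt_of_lt_one hδ hq1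
  refine ⟨M, fun m hm c => ?_⟩
  rw [evalSubdiv_apply]
  have hd : ∀ w : Fin (n + 1) → stdSimplex ℝ (Fin (N + 1)), ∀ i j, dist (w i) (w j) ≤ 1 :=
    fun w i j => (Metric.dist_le_diam_of_mem (bounded_stdSimplex _) (w i).2 (w j).2).trans
      diam_stdSimplex_le
  have hc := iterate_subdiv_mem_chainsOn (convex_stdSimplex ℝ (Fin (N + 1))) zero_le_one
    (mem_chainsOn_true hd c) m
  refine (AddSubgroup.mem_bot).mp (mem_of_mem_chainsOn _ ⊥ (fun v hv => ?_) hc)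
  rw [AddSubgroup.mem_bot, evalChain_of]
  obtain ⟨i, hi⟩ := hball (v 0) (Set.mem_univ _)
  refine ha i _ fun t => ?_
  rw [Equiv.apply_symm_apply]
  apply hi
  have : ((affineSimplex (convex_stdSimplex ℝ _) v t : stdSimplex ℝ (Fin (N + 1))) :
      Fin (N + 1) → ℝ) ∈ Metric.ball ((v 0 : stdSimplex ℝ (Fin (N + 1))) : Fin (N + 1) → ℝ) δ := by
    refine (convex_ball _ _).sum_mem (fun i _ => t.2.1 i) t.2.2 fun j _ => ?_
    refine (hv j 0).trans_lt ?_
    rw [mul_one]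
    exact (pow_le_pow_of_le_one hq0 hq1.le hm).trans_lt hM
  exact this

/-- A cocycle of positive degree that vanishes on the simplices lying in the members of an open
cover is a coboundary. -/
theorem mem_range_coboundary_of_vanishes_on_cover {ι : Type*} {U : ι → Set X}
    (hU : ∀ i, IsOpen (U i)) (hcov : ∀ x, ∃ i, x ∈ U i) {n : ℕ} {a : Cochain X R (n + 1)}
    (hda : coboundary X R (n + 1) a = 0)
    (ha : ∀ i (τ : SingularSimplex X (n + 1)), (∀ t, simplexEquiv X _ τ t ∈ U i) → a τ = 0) :
    a ∈ (coboundary X R n).range := by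
  choose M hM using fun (N : ℕ) (σ : SingularSimplex X N) =>
    evalSubdiv_eventually_eq_zero hU hcov ha σ
  have hsum : ∀ (N : ℕ) (σ : SingularSimplex X N) (m : ℕ), M N σ ≤ m → ∀ c,
      ∑ j ∈ Finset.range m, evalSubdiv a σ j c = ∑ j ∈ Finset.range (M N σ), evalSubdiv a σ j c := by
    intro N σ m hm c
    refine (Finset.sum_subset (Finset.range_mono hm) fun j _ hj => ?_).symm
    exact hM N σ j (by simpa using hj) c
  -- Formally the primitive is a ∘ ∑ⱼ SʲT, as ∂T + T∂ = 1 - S; on each σ only finitely many terms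
  -- are nonzero. The cut-off varies with σ, and `hsum` permits a common larger one when σ is
  -- compared with its faces.
  refine ⟨fun σ => ∑ j ∈ Finset.range (M n σ),
    evalSubdiv a σ j (stdSubdivHomotopy n (n + 1) (stdChain n)), ?_⟩
  funext σ
  rw [coboundary_eq_evalChain]
  set f : SingularSimplex X n → R := fun σ => ∑ j ∈ Finset.range (M n σ),
    evalSubdiv a σ j (stdSubdivHomotopy n (n + 1) (stdChain n)) with hf
  set g := simplexEquiv X (n + 1) σ with hg
  have hface : ∀ v : Fin (n + 1) → stdSimplex ℝ (Fin (n + 2)),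
      evalChain (convex_stdSimplex ℝ _) f g (.of v) =
        ∑ j ∈ Finset.range (M (n + 1) σ), evalSubdiv a σ j
          (stdSubdivHomotopy (n + 1) (n + 1) (.of v)) := by
    intro v
    rw [evalChain_of, hf]
    set τ := (simplexEquiv X n).symm (g.comp (affineSimplex (convex_stdSimplex ℝ _) v)) with hτ
    change ∑ j ∈ Finset.range (M n τ), _ = _
    rw [← hsum n τ (max (M n τ) (M (n + 1) σ)) (le_max_left _ _),
      ← hsum (n + 1) σ (max (M n τ) (M (n + 1) σ)) (le_max_right _ _)]
    refine Finset.sum_congr rfl fun j _ => ?_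
    rw [hτ, hg, evalSubdiv_comp,
      tupleMap_subdivHomotopy (affineSimplex_barycenter (convex_stdSimplex ℝ _) v),
      tupleMap_stdChain]
  have hall : ∀ c, evalChain (convex_stdSimplex ℝ _) f g c =
      ∑ j ∈ Finset.range (M (n + 1) σ), evalSubdiv a σ j
        (stdSubdivHomotopy (n + 1) (n + 1) c) := by
    intro c
    suffices h : evalChain (convex_stdSimplex ℝ _) f g =
        ∑ j ∈ Finset.range (M (n + 1) σ), (evalSubdiv a σ j).comp
          (stdSubdivHomotopy (n + 1) (n + 1)) by
      rw [h, AddMonoidHom.finsetSum_apply]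
      rfl
    ext v
    rw [hface, AddMonoidHom.finsetSum_apply]
    rfl
  rw [hall]
  -- The cocycle kills the term Sʲ∂T, so the sum telescopes to a(σ) minus a value that vanishes by
  -- the choice of the cut-off.
  have hstep : ∀ j, evalSubdiv a σ j (stdSubdivHomotopy (n + 1) (n + 1)
      (tupleBoundary (n + 1) (stdChain (n + 1)))) =
      evalSubdiv a σ j (stdChain (n + 1)) - evalSubdiv a σ (j + 1) (stdChain (n + 1)) := by
    intro j
    have h1 := congrArg (evalSubdiv a σ j)
      (subdivHomotopy_spec (barycenter (convex_stdSimplex ℝ (Fin (n + 2)))) (n + 1)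
        (stdChain (n + 1)))
    rw [map_add, evalSubdiv_tupleBoundary hda, zero_add, map_sub] at h1
    rw [h1]
    rfl
  rw [Finset.sum_congr rfl fun j _ => hstep j, Finset.sum_range_sub', hM (n + 1) σ _ le_rfl,
    sub_zero]
  exact evalChain_stdChain a σ

end Small

/-! ### Homotopy invariance -/

section Homotopy

variable {X Y : Type u} [TopologicalSpace X] [TopologicalSpace Y] {R : Type v} [Ring R]

/-- The cylinder over a standard simplex. -/
abbrev stdCylinder (n : ℕ) : Set ((Fin (n + 1) → ℝ) × ℝ) :=
  stdSimplex ℝ (Fin (n + 1)) ×ˢ Set.Icc (0 : ℝ) 1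

theorem convex_stdCylinder (n : ℕ) : Convex ℝ (stdCylinder n) :=
  (convex_stdSimplex ℝ _).prod (convex_Icc 0 1)

/-- The homotopy restricted to the cylinder over a singular simplex. -/
def cylinderMap (H : C(X × unitInterval, Y)) {n : ℕ} (g : C(stdSimplex ℝ (Fin (n + 1)), X)) :
    C(stdCylinder n, Y) where
  toFun p := H (g ⟨p.1.1, p.2.1⟩, ⟨p.1.2, p.2.2⟩)
  continuous_toFun := by fun_prop

/-- The inclusion of the standard simplex in the cylinder at height `s`. -/
def cylinderIncl (n : ℕ) (s : unitInterval) (t : stdSimplex ℝ (Fin (n + 1))) : stdCylinder n :=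
  ⟨(t.1, s.1), t.2, s.2⟩

/-- The map of cylinders over an affine map of simplices. -/
def cylinderAffine {m n : ℕ} (u : Fin (m + 1) → stdSimplex ℝ (Fin (n + 1))) :
    C(stdCylinder m, stdCylinder n) where
  toFun p := ⟨(affineSimplex (convex_stdSimplex ℝ _) u ⟨p.1.1, p.2.1⟩, p.1.2),
    (affineSimplex (convex_stdSimplex ℝ _) u ⟨p.1.1, p.2.1⟩).2, p.2.2⟩
  continuous_toFun := by fun_prop

theorem preservesAffine_cylinderAffine {m n : ℕ} (u : Fin (m + 1) → stdSimplex ℝ (Fin (n + 1))) :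
    PreservesAffine (convex_stdCylinder m) (convex_stdCylinder n) (cylinderAffine u) := by
  intro k v t
  have h1 := congrArg Subtype.val (preservesAffine_affineSimplex (convex_stdSimplex ℝ _) u k
    (fun i => ⟨(v i).1.1, (v i).2.1⟩) t)
  rw [affineSimplex_coe] at h1
  have h2 : (⟨((affineSimplex (convex_stdCylinder m) v t : stdCylinder m) :
      (Fin (m + 1) → ℝ) × ℝ).1, (affineSimplex (convex_stdCylinder m) v t).2.1⟩ :
      stdSimplex ℝ (Fin (m + 1))) =
      affineSimplex (convex_stdSimplex ℝ _) (fun i => ⟨(v i).1.1, (v i).2.1⟩) t := by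
    refine Subtype.ext ?_
    change ((affineSimplex (convex_stdCylinder m) v t : stdCylinder m) :
      (Fin (m + 1) → ℝ) × ℝ).1 = _
    rw [affineSimplex_coe, affineSimplex_coe, Prod.fst_sum]
    rfl
  refine Subtype.ext (Prod.ext ?_ ?_)
  · rw [affineSimplex_coe, Prod.fst_sum]
    refine Eq.trans ?_ h1
    exact congrArg (fun p => (affineSimplex (convex_stdSimplex ℝ _) u p : Fin (n + 1) → ℝ)) h2
  · change ((affineSimplex (convex_stdCylinder m) v t : stdCylinder m) :
      (Fin (m + 1) → ℝ) × ℝ).2 = _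
    rw [affineSimplex_coe, affineSimplex_coe, Prod.snd_sum, Prod.snd_sum]
    rfl

/-- The prism operator of a homotopy on cochains. -/
def prismPullback (H : C(X × unitInterval, Y)) {n : ℕ} (a : Cochain Y R (n + 1)) : Cochain X R n :=
  fun σ => evalChain (convex_stdCylinder n) a (cylinderMap H (simplexEquiv X n σ))
    (prism (cylinderIncl n 0) (cylinderIncl n 1) (n + 1) (stdChain n))

/-- Prisms are natural for maps u × id of cylinders with u affine. Hence the prism operator, defined
on one simplex at a time, is compatible with faces. -/
theorem evalChain_prismPullback (H : C(X × unitInterval, Y)) {n N : ℕ} (a : Cochain Y R (n + 1))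
    (g : C(stdSimplex ℝ (Fin (N + 1)), X)) (c : TupleChain (stdSimplex ℝ (Fin (N + 1))) (n + 1)) :
    evalChain (convex_stdSimplex ℝ _) (prismPullback H a) g c =
      evalChain (convex_stdCylinder N) a (cylinderMap H g)
        (prism (cylinderIncl N 0) (cylinderIncl N 1) (n + 1) c) := by
  suffices h : evalChain (convex_stdSimplex ℝ _) (prismPullback H a) g =
      (evalChain (convex_stdCylinder N) a (cylinderMap H g)).comp
        (prism (cylinderIncl N 0) (cylinderIncl N 1) (n + 1)) from DFunLike.congr_fun h c
  ext v
  simp only [AddMonoidHom.comp_apply]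
  rw [evalChain_of, prismPullback, Equiv.apply_symm_apply]
  have h1 : cylinderMap H (g.comp (affineSimplex (convex_stdSimplex ℝ _) v)) =
      (cylinderMap H g).comp (cylinderAffine v) := rfl
  rw [h1, evalChain_comp _ (convex_stdCylinder N) _ _ (preservesAffine_cylinderAffine v),
    tupleMap_prism (j₀ := cylinderIncl N 0) (j₁ := cylinderIncl N 1)
      (f := affineSimplex (convex_stdSimplex ℝ _) v) (f' := cylinderAffine v) (fun _ => rfl) (fun _ => rfl),
    tupleMap_stdChain]

/-- The end of a homotopy at time `s`. -/
def homotopyAt (H : C(X × unitInterval, Y)) (s : unitInterval) : C(X, Y) :=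
  H.comp ((ContinuousMap.id X).prodMk (ContinuousMap.const X s))

theorem evalChain_tupleMap_cylinderIncl (H : C(X × unitInterval, Y)) (s : unitInterval) {n : ℕ}
    (a : Cochain Y R n) (σ : SingularSimplex X n) :
    evalChain (convex_stdCylinder n) a (cylinderMap H (simplexEquiv X n σ))
      (tupleMap (cylinderIncl n s) (n + 1) (stdChain n)) =
    cochainPullback R (homotopyAt H s) n a σ := by
  let ι : C(stdSimplex ℝ (Fin (n + 1)), stdCylinder n) :=
    ⟨cylinderIncl n s, by unfold cylinderIncl; fun_prop⟩
  have hι : PreservesAffine (convex_stdSimplex ℝ _) (convex_stdCylinder n) ι := by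
    intro k v t
    refine Subtype.ext (Prod.ext ?_ ?_)
    · rw [affineSimplex_coe, Prod.fst_sum]
      rfl
    · rw [affineSimplex_coe, Prod.snd_sum]
      change (s : ℝ) = ∑ i, t i • (s : ℝ)
      rw [← Finset.sum_smul, stdSimplex.sum_eq_one, one_smul]
  have h := evalChain_comp (convex_stdSimplex ℝ _) (convex_stdCylinder n) a
    (cylinderMap H (simplexEquiv X n σ)) hι (stdChain n)
  refine h.symm.trans ?_
  exact evalChain_stdChain a ((TopCat.toSSet.map (TopCat.ofHom (homotopyAt H s))).app _ σ)

/-- This is `prism_spec` evaluated on a; the boundary of the prism contributes nothing because a is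
a cocycle. -/
theorem coboundary_prismPullback (H : C(X × unitInterval, Y)) {n : ℕ} (a : Cochain Y R (n + 1))
    (ha : coboundary Y R (n + 1) a = 0) :
    coboundary X R n (prismPullback H a) = cochainPullback R (homotopyAt H 1) (n + 1) a -
      cochainPullback R (homotopyAt H 0) (n + 1) a := by
  funext σ
  rw [coboundary_eq_evalChain, evalChain_prismPullback, Pi.sub_apply,
    ← evalChain_tupleMap_cylinderIncl, ← evalChain_tupleMap_cylinderIncl, ← map_sub,
    ← prism_spec, map_add, ← evalChain_coboundary, ha]
  have h0 : evalChain (convex_stdCylinder (n + 1)) (0 : Cochain Y R (n + 2))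
      (cylinderMap H (simplexEquiv X (n + 1) σ)) = 0 := by
    ext v
    rw [evalChain_of]
    rfl
  rw [h0, AddMonoidHom.zero_apply, zero_add]

/-- Homotopic maps induce the same homomorphism in cohomology of positive degree. -/
theorem pullback_eq_of_homotopy (H : C(X × unitInterval, Y)) {f g : C(X, Y)}
    (hf : ∀ x, H (x, 0) = f x) (hg : ∀ x, H (x, 1) = g x) {n : ℕ} (hn : 1 ≤ n)
    (α : Cohomology Y R n) : pullback R f n α = pullback R g n α := by
  obtain ⟨n, rfl⟩ : ∃ m, n = m + 1 := ⟨n - 1, by omega⟩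
  obtain rfl : homotopyAt H 0 = f := ContinuousMap.ext hf
  obtain rfl : homotopyAt H 1 = g := ContinuousMap.ext hg
  induction α using QuotientAddGroup.induction_on with
  | H a =>
    refine QuotientAddGroup.eq.mpr ?_
    rw [AddSubgroup.mem_addSubgroupOf]
    refine ⟨prismPullback H a.1, ?_⟩
    rw [coboundary_prismPullback H a.1 a.2, sub_eq_neg_add]
    rfl

theorem pullback_comp {Z : Type u} [TopologicalSpace Z] (g : C(Y, Z)) (f : C(X, Y)) (n : ℕ)
    (α : Cohomology Z R n) : pullback R f n (pullback R g n α) = pullback R (g.comp f) n α := by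
  induction α using QuotientAddGroup.induction_on with
  | H a => rfl

end Homotopy

/-! ### Cup products of classes vanishing on an open cover -/

section CupLength

variable {X : Type u} [TopologicalSpace X] {R : Type v} [Ring R]

theorem coboundary_coboundary {n : ℕ} (a : Cochain X R n) :
    coboundary X R (n + 1) (coboundary X R n a) = 0 := by
  funext σ
  rw [coboundary_eq_evalChain, evalChain_coboundary, tupleBoundary_tupleBoundary, map_zero]
  rfl

/-- The inclusion of a subspace. -/
abbrev subspaceIncl (U : Set X) : C(U, X) := ⟨Subtype.val, continuous_subtype_val⟩

/-- A class that vanishes on a subspace is represented by a cocycle that vanishes on the simplices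
of the subspace. -/
theorem exists_cocycle_vanishing (U : Set X) {n : ℕ} (β : Cohomology X R n)
    (hβ : pullback R (subspaceIncl U) n β = 0) :
    ∃ a : cocycles X R n, (QuotientAddGroup.mk a : Cohomology X R n) = β ∧
      ∀ τ : SingularSimplex X n, (∀ t, simplexEquiv X n τ t ∈ U) → a.1 τ = 0 := by
  classical
  have hlift : ∀ (m : ℕ) (τ : SingularSimplex X m), (∀ t, simplexEquiv X m τ t ∈ U) →
      ∃ ρ : SingularSimplex U m, (TopCat.toSSet.map (TopCat.ofHom (subspaceIncl U))).app _ ρ = τ := by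
    intro m τ hτ
    refine ⟨(simplexEquiv U m).symm ⟨fun t => ⟨_, hτ t⟩,
      (simplexEquiv X m τ).continuous.subtype_mk _⟩, ?_⟩
    apply (simplexEquiv X m).injective
    rw [simplexEquiv_pushforward, Equiv.apply_symm_apply]
    rfl
  have hinj : ∀ m : ℕ, Function.Injective fun ρ : SingularSimplex U m =>
      (TopCat.toSSet.map (TopCat.ofHom (subspaceIncl U))).app _ ρ := by
    intro m ρ ρ' h
    have h' := congrArg (simplexEquiv X m) h
    simp only [simplexEquiv_pushforward] at h'
    apply (simplexEquiv U m).injective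
    ext t
    exact DFunLike.congr_fun h' t
  induction β using QuotientAddGroup.induction_on with
  | H a =>
    have h := (QuotientAddGroup.eq_zero_iff _).mp hβ
    rw [AddSubgroup.mem_addSubgroupOf] at h
    cases n with
    | zero =>
      refine ⟨a, rfl, fun τ hτ => ?_⟩
      obtain ⟨ρ, rfl⟩ := hlift 0 τ hτ
      exact congrFun (show cochainPullback R (subspaceIncl U) 0 a.1 = 0 from h) ρ
    | succ n =>
      obtain ⟨c, hc⟩ := h
      -- The primitive on U is extended by zero to the simplices that leave U; subtracting its
      -- coboundary from a keeps the class and kills the simplices in U.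
      let c' : Cochain X R n := Function.extend
        (fun ρ : SingularSimplex U n => (TopCat.toSSet.map (TopCat.ofHom (subspaceIncl U))).app _ ρ)
        c 0
      have hc' : cochainPullback R (subspaceIncl U) n c' = c := by
        funext ρ
        exact (hinj n).extend_apply c 0 ρ
      have hd : coboundary X R n c' ∈ cocycles X R (n + 1) := coboundary_coboundary c'
      refine ⟨a - ⟨coboundary X R n c', hd⟩, ?_, fun τ hτ => ?_⟩
      · refine QuotientAddGroup.eq.mpr ?_
        rw [AddSubgroup.mem_addSubgroupOf]
        refine ⟨c', ?_⟩
        change _ = -(a.1 - coboundary X R n c') + a.1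
        abel
      · obtain ⟨ρ, rfl⟩ := hlift _ τ hτ
        have h1 := congrFun hc ρ
        rw [← hc', coboundary_cochainPullback] at h1
        exact sub_eq_zero.mpr h1.symm

/-- Front and back faces of a simplex in U i stay in U i, so one factor of the product cocycle
vanishes there. This replaces the relative cup product. -/
theorem iteratedCup_eq_mk {n m : ℕ} (k : Fin n → ℕ) (h : ∑ i, k i = m) (U : Fin n → Set X)
    (β : (i : Fin n) → Cohomology X R (k i))
    (hβ : ∀ i, ∃ a : cocycles X R (k i), (QuotientAddGroup.mk a : Cohomology X R (k i)) = β i ∧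
      ∀ τ : SingularSimplex X (k i), (∀ t, simplexEquiv X (k i) τ t ∈ U i) → a.1 τ = 0) :
    ∃ a : cocycles X R m, (QuotientAddGroup.mk a : Cohomology X R m) = iteratedCup k h β ∧
      ∀ i (τ : SingularSimplex X m), (∀ t, simplexEquiv X m τ t ∈ U i) → a.1 τ = 0 := by
  induction n generalizing m with
  | zero => exact ⟨_, rfl, fun i => i.elim0⟩
  | succ n ih =>
    obtain ⟨b, hb, hb0⟩ := ih (fun i => k i.succ) rfl (fun i => U i.succ) (fun i => β i.succ)
      (fun i => hβ i.succ)
    obtain ⟨a, ha, ha0⟩ := hβ 0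
    refine ⟨⟨cochainCup ((Fin.sum_univ_succ k).symm.trans h) a.1 b.1,
      cochainCup_mem_cocycles _ a.2 b.2⟩, ?_, fun i τ hτ => ?_⟩
    · rw [iteratedCup, ← ha, ← hb]
      rfl
    · refine Fin.cases (fun hτ => ?_) (fun i hτ => ?_) i hτ
      · refine mul_eq_zero_of_left (ha0 _ fun t => ?_) _
        exact hτ _
      · refine mul_eq_zero_of_right _ (hb0 i _ fun t => ?_)
        exact hτ _

/-- If each of the classes `β i` vanishes on a member of an open cover indexed by the classes, then
their cup product is zero. -/
theorem iteratedCup_eq_zero {n : ℕ} (hn : 1 ≤ n) (k : Fin n → ℕ) (hk : ∀ i, 1 ≤ k i)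
    {U : Fin n → Set X} (hU : ∀ i, IsOpen (U i)) (hcov : ∀ x, ∃ i, x ∈ U i)
    (β : (i : Fin n) → Cohomology X R (k i))
    (hβ : ∀ i, pullback R (subspaceIncl (U i)) (k i) (β i) = 0) :
    iteratedCup k rfl β = 0 := by
  obtain ⟨a, ha, ha0⟩ := iteratedCup_eq_mk k rfl U β
    fun i => exists_cocycle_vanishing (U i) (β i) (hβ i)
  rw [← ha]
  have hm : 1 ≤ ∑ i, k i :=
    (hk ⟨0, hn⟩).trans (Finset.single_le_sum (f := k) (fun _ _ => Nat.zero_le _) (Finset.mem_univ _))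
  refine (QuotientAddGroup.eq_zero_iff _).mpr ?_
  rw [AddSubgroup.mem_addSubgroupOf]
  clear ha
  generalize ∑ i, k i = m at a ha0 hm
  obtain ⟨m, rfl⟩ : ∃ l, m = l + 1 := ⟨m - 1, by omega⟩
  exact mem_range_coboundary_of_vanishes_on_cover hU hcov a.2 ha0

end CupLength

/-! ### Neighbourhood retractions in normed spaces -/

section Retract

open scoped BoundedContinuousFunction

variable {X : Type u} [MetricSpace X]

/-- The Kuratowski embedding with base point `x₀`. -/
def kuratowski (x₀ x : X) : X →ᵇ ℝ :=
  BoundedContinuousFunction.ofNormedAddCommGroup (fun w => dist x w - dist x₀ w) (by fun_prop)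
    (dist x x₀) fun w => abs_dist_sub_le x x₀ w

theorem kuratowski_apply (x₀ x w : X) : kuratowski x₀ x w = dist x w - dist x₀ w := rfl

theorem isometry_kuratowski (x₀ : X) : Isometry (kuratowski x₀) := by
  refine Isometry.of_dist_eq fun x y => le_antisymm ?_ ?_
  · refine (BoundedContinuousFunction.dist_le dist_nonneg).mpr fun w => ?_
    rw [kuratowski_apply, kuratowski_apply, Real.dist_eq, sub_sub_sub_cancel_right]
    exact abs_dist_sub_le x y w
  · refine le_trans ?_ (BoundedContinuousFunction.dist_coe_le_dist y)
    rw [kuratowski_apply, kuratowski_apply, Real.dist_eq, sub_sub_sub_cancel_right, dist_self,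
      sub_zero]
    exact le_abs_self _

/-- For f in the hull, f + dist x₀ is a convex combination of functions dist x. These are
nonnegative, so any term with positive weight is a lower bound. -/
theorem exists_mul_dist_le_of_mem_convexHull (x₀ : X) {f : X →ᵇ ℝ}
    (hf : f ∈ convexHull ℝ (Set.range (kuratowski x₀))) :
    ∃ x : X, ∃ t : ℝ, 0 < t ∧ ∀ y, t * dist x y ≤ f y + dist x₀ y := by
  have hnn : ∀ {g : X →ᵇ ℝ}, (∃ x : X, ∃ t : ℝ, 0 < t ∧ ∀ y, t * dist x y ≤ g y + dist x₀ y) →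
      ∀ y, 0 ≤ g y + dist x₀ y := by
    rintro g ⟨x, t, ht, h⟩ y
    exact le_trans (by positivity) (h y)
  suffices h : convexHull ℝ (Set.range (kuratowski x₀)) ⊆
      {f | ∃ x : X, ∃ t : ℝ, 0 < t ∧ ∀ y, t * dist x y ≤ f y + dist x₀ y} from h hf
  refine convexHull_min ?_ fun f hf g hg a b ha hb hab => ?_
  · rintro _ ⟨x, rfl⟩
    exact ⟨x, 1, one_pos, fun y => by rw [kuratowski_apply]; linarith⟩
  · have key : ∀ y, (a • f + b • g : X →ᵇ ℝ) y + dist x₀ y =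
        a * (f y + dist x₀ y) + b * (g y + dist x₀ y) := by
      intro y
      have : dist x₀ y = (a + b) * dist x₀ y := by rw [hab, one_mul]
      simp only [BoundedContinuousFunction.coe_add, BoundedContinuousFunction.coe_smul,
        Pi.add_apply, smul_eq_mul]
      linarith
    rcases ha.eq_or_lt with rfl | ha
    · obtain ⟨x, t, ht, h⟩ := hg
      refine ⟨x, t, ht, fun y => ?_⟩
      rw [key, zero_mul, zero_add, show b = 1 by linarith, one_mul]
      exact h y
    · obtain ⟨x, t, ht, h⟩ := hf
      refine ⟨x, a * t, by positivity, fun y => ?_⟩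
      rw [key, mul_assoc]
      have h1 := mul_le_mul_of_nonneg_left (h y) ha.le
      have h2 := mul_nonneg hb (hnn hg y)
      linarith

/-- If images of points y converge to f in the hull, then f y + dist x₀ y tends to 0, because the
image of y plus dist x₀ vanishes at y. The linear lower bound forces y to converge to x, so f is the
image of x. -/
theorem isClosedEmbedding_kuratowski (x₀ : X) :
    Topology.IsClosedEmbedding (fun x => (⟨kuratowski x₀ x, subset_convexHull ℝ _ ⟨x, rfl⟩⟩ :
      convexHull ℝ (Set.range (kuratowski x₀)))) := by
  refine ⟨Isometry.isEmbedding fun x y => isometry_kuratowski x₀ x y, ?_⟩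
  refine isClosed_of_closure_subset ?_
  rintro ⟨f, hf⟩ hcl
  obtain ⟨x, t, ht, hx⟩ := exists_mul_dist_le_of_mem_convexHull x₀ hf
  refine ⟨x, Subtype.ext (eq_of_forall_dist_le fun ε hε => ?_)⟩
  -- With this η, the two distances in the triangle inequality are at most η / t and η, with sum ε.
  have hε' : 0 < ε / (1 + 1 / t) := by positivity
  obtain ⟨_, ⟨y, rfl⟩, hy⟩ := Metric.mem_closure_iff.mp hcl _ hε'
  have hy' : dist f (kuratowski x₀ y) < ε / (1 + 1 / t) := hy
  have h1 : f y + dist x₀ y ≤ ε / (1 + 1 / t) := by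
    have h := (BoundedContinuousFunction.dist_coe_le_dist y).trans hy'.le
    rw [kuratowski_apply, Real.dist_eq, dist_self] at h
    linarith [le_abs_self (f y - (0 - dist x₀ y))]
  have h2 : dist x y ≤ ε / (1 + 1 / t) * (1 / t) := by
    rw [mul_one_div, le_div_iff₀ ht, mul_comm]
    exact (hx y).trans h1
  calc dist (kuratowski x₀ x) f ≤ dist (kuratowski x₀ x) (kuratowski x₀ y) +
        dist (kuratowski x₀ y) f := dist_triangle _ _ _
    _ ≤ ε / (1 + 1 / t) * (1 / t) + ε / (1 + 1 / t) := by
        rw [(isometry_kuratowski x₀).dist_eq, dist_comm _ f]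
        exact add_le_add h2 hy'.le
    _ = ε := by field_simp; ring

/-- A metric ANR is isometric to a subset of a convex subset `C` of a normed space, on a
neighbourhood of which in `C` there is a retraction. -/
theorem IsANR.exists_retraction (hX : IsANR X) (x₀ : X) :
    ∃ (C O : Set (X →ᵇ ℝ)) (r : (X →ᵇ ℝ) → X), Convex ℝ C ∧ IsOpen O ∧
      (∀ x, kuratowski x₀ x ∈ O ∩ C) ∧ ContinuousOn r (O ∩ C) ∧ ∀ x, r (kuratowski x₀ x) = x := by
  classical
  obtain ⟨U, hU, hrange, r, hr, hre⟩ := hX.2 _ _ (isClosedEmbedding_kuratowski x₀)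
  obtain ⟨O, hO, rfl⟩ := isOpen_induced_iff.mp hU
  refine ⟨convexHull ℝ (Set.range (kuratowski x₀)), O,
    -- The value x₀ off the hull is arbitrary: continuity is claimed only on O ∩ C.
    fun f => if h : f ∈ convexHull ℝ (Set.range (kuratowski x₀)) then r ⟨f, h⟩ else x₀, convex_convexHull ℝ _, hO,
    fun x => ⟨hrange ⟨x, rfl⟩, subset_convexHull ℝ _ ⟨x, rfl⟩⟩, ?_, fun x => ?_⟩
  · rw [Set.inter_comm, ← Subtype.image_preimage_coe,
      Topology.IsInducing.subtypeVal.continuousOn_image_iff]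
    exact hr.congr fun p _ => dif_pos p.2
  · exact (dif_pos (subset_convexHull ℝ _ (Set.mem_range_self x))).trans (hre x)

end Retract

/-! ### Supports of finitely supported measures -/

section Support

variable {Z P : Type*} [TopologicalSpace Z] [MeasurableSpace P]

/-- A measure that is supported by at most `k` points of `A` has a finite set of atoms in `A`, and
is supported by it. -/
theorem exists_atoms {k : ℕ} {A : Set P} {μ : LevyProkhorov (ProbabilityMeasure P)}
    (hμ : μ ∈ finSupported k A) :
    ∃ F : Finset P, 1 ≤ F.card ∧ F.card ≤ k ∧ (F : Set P) ⊆ A ∧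
      (∀ φ ∈ F, (μ.toMeasure : Measure P) {φ} ≠ 0) ∧ (μ.toMeasure : Measure P) (F : Set P)ᶜ = 0 := by
  classical
  obtain ⟨F, hk, hFA, hF⟩ := hμ
  set G := F.filter fun φ => (μ.toMeasure : Measure P) {φ} ≠ 0 with hG
  have hG0 : (μ.toMeasure : Measure P) (G : Set P)ᶜ = 0 := by
    have hsub : (G : Set P)ᶜ ⊆ (F : Set P)ᶜ ∪
        ⋃ φ ∈ F.filter fun φ => (μ.toMeasure : Measure P) {φ} = 0, {φ} := by
      intro φ hφ
      by_cases h : φ ∈ F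
      · refine Or.inr (Set.mem_biUnion (x := φ) ?_ rfl)
        by_contra h'
        refine hφ (Finset.mem_coe.mpr (Finset.mem_filter.mpr ⟨h, fun h0 => h' ?_⟩))
        exact Finset.mem_coe.mpr (Finset.mem_filter.mpr ⟨h, h0⟩)
      · exact Or.inl h
    refine measure_mono_null hsub (measure_union_null hF ?_)
    refine (measure_biUnion_null_iff (Finset.countable_toSet _)).mpr fun φ hφ => ?_
    exact (Finset.mem_filter.mp hφ).2
  refine ⟨G, ?_, (Finset.card_filter_le _ _).trans hk, ?_, ?_, hG0⟩
  · rw [Nat.one_le_iff_ne_zero, Finset.card_ne_zero]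
    by_contra h
    rw [Finset.not_nonempty_iff_eq_empty.mp h] at hG0
    simp at hG0
  · exact fun φ hφ => hFA (Finset.filter_subset _ _ hφ)
  · exact fun φ hφ => (Finset.mem_filter.mp hφ).2

/-- The atoms of a measure are close to atoms of any nearby finitely supported measure. -/
theorem eventually_atoms_close [PseudoMetricSpace P] [BorelSpace P] [MeasurableSingletonClass P]
    {s : Z → LevyProkhorov (ProbabilityMeasure P)} (hs : Continuous s)
    {F : Z → Finset P} (h1 : ∀ z, ∀ φ ∈ F z, ((s z).toMeasure : Measure P) {φ} ≠ 0)
    (h2 : ∀ z, ((s z).toMeasure : Measure P) (F z : Set P)ᶜ = 0) (a : Z) {ε : ℝ} (hε : 0 < ε) :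
    ∀ᶠ z in nhds a, ∀ φ ∈ F a, ∃ ψ ∈ F z, dist φ ψ < ε := by
  rw [Filter.eventually_all_finset]
  intro φ hφ
  -- At distance below c, the mass of φ is at most the nearby measure of the c-thickening of φ plus
  -- half that mass. So the thickening, contained in the ε-ball, has positive measure and contains
  -- an atom.
  set c := min (ENNReal.ofReal ε) (((s a).toMeasure : Measure P) {φ} / 2) with hc
  have hc0 : 0 < c := lt_min (ENNReal.ofReal_pos.mpr hε) (ENNReal.half_pos (h1 a φ hφ))
  have hnear : ∀ᶠ z in nhds a, edist (s a) (s z) < c := by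
    have := hs.continuousAt (x := a) (Metric.eball_mem_nhds (s a) hc0)
    filter_upwards [this] with z hz
    rw [edist_comm]
    exact hz
  filter_upwards [hnear] with z hz
  rw [LevyProkhorov.edist_probabilityMeasure_def] at hz
  have hlp := left_measure_le_of_levyProkhorovEDist_lt hz (measurableSet_singleton φ)
  by_contra! hno
  have hzero : ((s z).toMeasure : Measure P) (Metric.thickening c.toReal {φ}) = 0 := by
    refine measure_mono_null (fun ψ hψ => ?_) (h2 z)
    intro hψF
    rw [Metric.thickening_singleton, Metric.mem_ball] at hψ
    have hcε : c.toReal ≤ ε := ENNReal.toReal_le_of_le_ofReal hε.le (min_le_left _ _)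
    have := hno ψ hψF
    rw [dist_comm] at this
    linarith
  rw [hzero, zero_add] at hlp
  have : ((s a).toMeasure : Measure P) {φ} ≤ ((s a).toMeasure : Measure P) {φ} / 2 :=
    hlp.trans (min_le_right _ _)
  exact absurd this (not_le.mpr (ENNReal.half_lt_self (h1 a φ hφ) (measure_ne_top _ _)))

end Support

/-! ### Continuous families of finite sets of paths -/

section Branches

open scoped BoundedContinuousFunction

variable {X : Type u} [MetricSpace X]

/-- A continuous family of sets of `i` paths, indexed by the points of a subset `A` of `X × X`, with
prescribed end points, enumerated at each point of `A`: the paths at `a` are `4 * eps a`-separated,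
they are `eps a`-close to the paths at the points of distance less than `2 * rad a`, and the
`eps a`-neighbourhoods of their Kuratowski images are contained in `O`. -/
structure Branches (x₀ : X) (O : Set (X →ᵇ ℝ)) (i : ℕ) (A : Set (X × X)) where
  path : A → Fin i → PathSpace X
  rad : A → ℝ
  eps : A → ℝ
  rad_pos : ∀ a, 0 < rad a
  rad_le : ∀ a, rad a ≤ eps a
  path_zero : ∀ a j, path a j 0 = a.1.1
  path_one : ∀ a j, path a j 1 = a.1.2
  separated : ∀ a j j', j ≠ j' → 4 * eps a ≤ dist (path a j) (path a j')
  ball_subset : ∀ a j t, Metric.ball (kuratowski x₀ (path a j t)) (eps a) ⊆ O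
  matched : ∀ a b : A, dist a b < 2 * rad a →
    ∃ σ : Equiv.Perm (Fin i), ∀ j, dist (path a j) (path b (σ j)) < eps a

/-- Closeness in one direction suffices where the cardinality is constant: separation makes the
choice of nearby paths injective, and an injection between sets of i elements is a bijection. -/
theorem exists_branches (x₀ : X) {O : Set (X →ᵇ ℝ)} (hO : IsOpen O) (hκ : ∀ x, kuratowski x₀ x ∈ O)
    {F : X × X → Finset (PathSpace X)}
    (hF : ∀ z, (F z : Set (PathSpace X)) ⊆ pathsBetween z.1 z.2)
    (hclose : ∀ a, ∀ ε > 0, ∀ᶠ z in nhds a, ∀ φ ∈ F a, ∃ ψ ∈ F z, dist φ ψ < ε) (i : ℕ) :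
    Nonempty (Branches x₀ O i {z | (F z).card = i}) := by
  set A := {z | (F z).card = i}
  let e : ∀ a : A, F a.1 ≃ Fin i := fun a => (F a.1).equivFinOfCardEq a.2
  let Φ : A → Fin i → PathSpace X := fun a j => ((e a).symm j).1
  have hΦmem : ∀ a j, Φ a j ∈ F a.1 := fun a j => ((e a).symm j).2
  have hΦinj : ∀ a, Function.Injective (Φ a) :=
    fun a => Subtype.val_injective.comp (e a).symm.injective
  have heps : ∀ a : A, ∃ ε : ℝ, 0 < ε ∧ (∀ j j', j ≠ j' → 4 * ε ≤ dist (Φ a j) (Φ a j')) ∧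
      ∀ j t, Metric.ball (kuratowski x₀ (Φ a j t)) ε ⊆ O := by
    intro a
    have h1 : ∀ᶠ ε in nhdsWithin (0 : ℝ) (Set.Ioi 0),
        ∀ j j', j ≠ j' → 4 * ε ≤ dist (Φ a j) (Φ a j') := by
      rw [Filter.eventually_all]
      intro j
      rw [Filter.eventually_all]
      intro j'
      by_cases hj : j = j'
      · exact Filter.Eventually.of_forall fun _ h => absurd hj h
      · have hd : 0 < dist (Φ a j) (Φ a j') / 4 :=
          div_pos (dist_pos.mpr fun h => hj (hΦinj a h)) (by norm_num)
        filter_upwards [Ioo_mem_nhdsGT hd] with ε hε _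
        linarith [hε.2]
    have h2 : ∀ᶠ ε in nhdsWithin (0 : ℝ) (Set.Ioi 0),
        ∀ j t, Metric.ball (kuratowski x₀ (Φ a j t)) ε ⊆ O := by
      rw [Filter.eventually_all]
      intro j
      have hcont : Continuous fun t => kuratowski x₀ (Φ a j t) :=
        (isometry_kuratowski x₀).continuous.comp (Φ a j).continuous
      -- Compactness of the path gives one radius for all times t.
      obtain ⟨δ, hδ, hsub⟩ := (isCompact_range hcont).exists_thickening_subset_open hO
        (by rintro _ ⟨t, rfl⟩; exact hκ _)
      filter_upwards [Ioo_mem_nhdsGT hδ] with ε hε t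
      refine subset_trans (fun y hy => ?_) hsub
      exact Metric.mem_thickening_iff.mpr ⟨_, ⟨t, rfl⟩, lt_trans hy hε.2⟩
    obtain ⟨ε, ⟨h1, h2⟩, h3⟩ := ((h1.and h2).and self_mem_nhdsWithin).exists
    exact ⟨ε, h3, h1, h2⟩
  choose eps heps0 hsep hball using heps
  have hrad : ∀ a : A, ∃ δ > 0, ∀ z : X × X, dist z a.1 < δ →
      ∀ φ ∈ F a.1, ∃ ψ ∈ F z, dist φ ψ < eps a := fun a =>
    Metric.eventually_nhds_iff.mp (hclose a.1 (eps a) (heps0 a)) |>.imp fun δ h =>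
      ⟨h.1, fun z hz => h.2 hz⟩
  choose δ hδ hδF using hrad
  refine ⟨⟨Φ, fun a => min (eps a) (δ a / 2), eps, fun a => lt_min (heps0 a) (half_pos (hδ a)),
    fun a => min_le_left _ _, fun a j => (hF a.1 (hΦmem a j)).1, fun a j => (hF a.1 (hΦmem a j)).2,
    hsep, hball, fun a b hab => ?_⟩⟩
  have hab' : dist b.1 a.1 < δ a := by
    rw [dist_comm]
    refine lt_of_lt_of_le hab ?_
    linarith [min_le_right (eps a) (δ a / 2)]
  choose f hfF hf using fun j => hδF a b.1 hab' (Φ a j) (hΦmem a j)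
  let g : Fin i → Fin i := fun j => e b ⟨f j, hfF j⟩
  have hg : ∀ j, Φ b (g j) = f j := fun j => by simp [Φ, g]
  have hginj : Function.Injective g := by
    intro j j' hjj'
    by_contra hne
    have h1 := hsep a j j' hne
    have h2 : f j = f j' := by rw [← hg, ← hg, hjj']
    have h3 := dist_triangle_right (Φ a j) (Φ a j') (f j)
    have h4 := hf j
    have h5 := hf j'
    rw [← h2] at h5
    linarith [heps0 a]
  refine ⟨Equiv.ofBijective g (Finite.injective_iff_bijective.mp hginj), fun j => ?_⟩
  rw [Equiv.ofBijective_apply, hg]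
  exact hf j

end Branches

/-! ### Extension of the branches to an open neighbourhood, and the resulting homotopies -/

namespace Branches

open scoped BoundedContinuousFunction

variable {X : Type u} [MetricSpace X] {x₀ : X} {O C : Set (X →ᵇ ℝ)} {i : ℕ} {A : Set (X × X)}
  (D : Branches x₀ O i A)

/-- The neighbourhood of `A` on which the family of paths is extended. -/
def nbhd : Set (X × X) := ⋃ a : A, Metric.ball a.1 (D.rad a)

theorem isOpen_nbhd : IsOpen D.nbhd := isOpen_iUnion fun _ => Metric.isOpen_ball

theorem subset_nbhd : A ⊆ D.nbhd := fun a ha =>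
  Set.mem_iUnion.mpr ⟨⟨a, ha⟩, Metric.mem_ball_self (D.rad_pos _)⟩

theorem exists_partitionOfUnity :
    ∃ ρ : PartitionOfUnity A D.nbhd Set.univ,
      ∀ a (w : D.nbhd), w ∈ tsupport (ρ a) → dist w.1 a.1 < D.rad a := by
  obtain ⟨ρ, hρ⟩ := PartitionOfUnity.exists_isSubordinate (X := D.nbhd) isClosed_univ
    (fun a : A => Subtype.val ⁻¹' Metric.ball a.1 (D.rad a))
    (fun a => Metric.isOpen_ball.preimage continuous_subtype_val) (by
      intro w _
      obtain ⟨a, ha⟩ := Set.mem_iUnion.mp w.2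
      exact Set.mem_iUnion.mpr ⟨a, ha⟩)
  exact ⟨ρ, fun a w hw => hρ a hw⟩

open Classical in
/-- The permutation that matches the paths at `a` with the paths at a nearby point `b`. -/
def matching (a b : A) : Equiv.Perm (Fin i) :=
  if h : dist a b < 2 * D.rad a then (D.matched a b h).choose else 1

theorem dist_matching {a b : A} (h : dist a b < 2 * D.rad a) (j : Fin i) :
    dist (D.path a j) (D.path b (D.matching a b j)) < D.eps a := by
  rw [matching, dif_pos h]
  exact (D.matched a b h).choose_spec j

theorem eps_pos (a : A) : 0 < D.eps a := (D.rad_pos a).trans_le (D.rad_le a)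

/-- A failure yields two distinct paths at a, whose separation gives 4 ε_a < 2 ε_a + ε_b, while
separation of their matches at b gives 4 ε_b < 4 ε_a + ε_b. These are incompatible, which is what
the factor 4 is for. -/
theorem matching_trans {a b c : A} (hab : dist a b < 2 * D.rad a) (hac : dist a c < 2 * D.rad a)
    (hbc : dist b c < 2 * D.rad b) (j : Fin i) :
    D.matching b c (D.matching a b j) = D.matching a c j := by
  by_contra hne
  obtain ⟨j', hj'⟩ := (D.matching a c).surjective (D.matching b c (D.matching a b j))
  have hjj' : j ≠ j' := by
    rintro rfl
    exact hne hj'.symm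
  have h1 := D.dist_matching hab j
  have h2 := D.dist_matching hab j'
  have h3 := D.dist_matching hac j'
  have h4 := D.dist_matching hbc (D.matching a b j)
  rw [hj'] at h3
  have s1 := D.separated a j j' hjj'
  have s2 := D.separated b _ _ ((D.matching a b).injective.ne hjj')
  have t1 := dist_triangle4 (D.path a j) (D.path b (D.matching a b j))
    (D.path c (D.matching b c (D.matching a b j))) (D.path a j')
  have t2 := dist_triangle4 (D.path b (D.matching a b j)) (D.path a j) (D.path a j')
    (D.path b (D.matching a b j'))
  have c1 := dist_comm (D.path c (D.matching b c (D.matching a b j))) (D.path a j')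
  have c2 := dist_comm (D.path b (D.matching a b j)) (D.path a j)
  linarith [D.eps_pos a]

variable (ρ : PartitionOfUnity A D.nbhd Set.univ)

/-- The `j`-th path at `w`, seen from `a`: a weighted mean of paths. -/
def mean (a : A) (j : Fin i) (p : D.nbhd × unitInterval) : X →ᵇ ℝ :=
  ∑ᶠ b, ρ b p.1 • kuratowski x₀ (D.path b (D.matching a b j) p.2)

theorem continuous_mean (a : A) (j : Fin i) : Continuous (D.mean ρ a j) := by
  refine continuous_finsum (fun b => ?_) ?_
  · exact ((ρ b).continuous.comp continuous_fst).smul ((isometry_kuratowski x₀).continuous.comp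
      ((D.path b (D.matching a b j)).continuous.comp continuous_snd))
  · refine (ρ.locallyFinite.preimage_continuous
      (continuous_fst : Continuous (Prod.fst : D.nbhd × unitInterval → D.nbhd))).subset ?_
    intro b p hp
    exact left_ne_zero_of_smul hp

/-- The point `a` dominates `w` if all the points of `A` that are active at `w` are close to `a`. -/
def Dominates (a : A) (w : D.nbhd) : Prop := ∀ b, ρ b w ≠ 0 → dist a b < 2 * D.rad a

variable {D ρ}

theorem finsum_smul_mem {V : Set (X →ᵇ ℝ)} (hV : Convex ℝ V) (w : D.nbhd) {f : A → X →ᵇ ℝ}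
    (hf : ∀ b, ρ b w ≠ 0 → f b ∈ V) : ∑ᶠ b, ρ b w • f b ∈ V :=
  hV.finsum_mem (fun b => ρ.nonneg b w) (ρ.sum_eq_one (Set.mem_univ _)) hf

/-- All active matched paths lie in the `eps a`-ball about the j-th path at a, which is convex and
contained in O. -/
theorem mean_mem (hC : Convex ℝ C) (hCκ : ∀ x, kuratowski x₀ x ∈ C) {a : A} {w : D.nbhd}
    (h : D.Dominates ρ a w) (j : Fin i) (t : unitInterval) : D.mean ρ a j (w, t) ∈ O ∩ C := by
  refine ⟨D.ball_subset a j t ?_, finsum_smul_mem hC w fun _ _ => hCκ _⟩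
  refine finsum_smul_mem (convex_ball _ _) w fun b hb => ?_
  rw [Metric.mem_ball, (isometry_kuratowski x₀).dist_eq, dist_comm]
  exact (ContinuousMap.dist_apply_le_dist t).trans_lt (D.dist_matching (h b hb) j)

/-- A change of the reference point only permutes the means, so their unordered collection is well
defined. -/
theorem mean_matching {a b : A} {w : D.nbhd} (ha : D.Dominates ρ a w) (hb : D.Dominates ρ b w)
    (hab : dist a b < 2 * D.rad a) (j : Fin i) (t : unitInterval) :
    D.mean ρ b (D.matching a b j) (w, t) = D.mean ρ a j (w, t) := by
  refine finsum_congr fun c => ?_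
  by_cases hc : ρ c w = 0
  · simp only [hc, zero_smul]
  · rw [D.matching_trans hab (ha c hc) (hb c hc)]

/-- If the partition of unity is subordinate to the balls of radius `rad a`, then near `w` there is
a point that dominates every nearby point and is close to every point active there. -/
theorem exists_dominates (hρ : ∀ a (w : D.nbhd), w ∈ tsupport (ρ a) → dist w.1 a.1 < D.rad a)
    {w : D.nbhd} {S : Finset A} (hS : S.Nonempty) (hSw : ∀ a ∈ S, w ∈ tsupport (ρ a)) :
    ∃ a ∈ S, ∀ b ∈ S, dist a b < 2 * D.rad a := by
  -- With the largest radius at a, dist a b < rad a + rad b ≤ 2 rad a.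
  obtain ⟨a, ha, hmax⟩ := S.exists_max_image D.rad hS
  refine ⟨a, ha, fun b hb => ?_⟩
  have h1 := hρ a w (hSw a ha)
  have h2 := hρ b w (hSw b hb)
  have h3 := hmax b hb
  have h4 : dist a.1 b.1 ≤ dist w.1 a.1 + dist w.1 b.1 := dist_triangle_left _ _ _
  change dist a.1 b.1 < _
  linarith

/-- The lead is itself active at w, so any other dominating point is close enough to be matched with
it. -/
theorem exists_lead (hρ : ∀ a (w : D.nbhd), w ∈ tsupport (ρ a) → dist w.1 a.1 < D.rad a)
    (w : D.nbhd) : ∃ a, ρ a w ≠ 0 ∧ D.Dominates ρ a w := by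
  obtain ⟨a₀, h₀⟩ := ρ.exists_pos (Set.mem_univ w)
  obtain ⟨a, ha, h⟩ := exists_dominates hρ (w := w) (S := ρ.finsupport w)
    ⟨a₀, (ρ.mem_finsupport w).mpr h₀.ne'⟩
    fun a ha => subset_closure ((ρ.mem_finsupport w).mp ha)
  exact ⟨a, (ρ.mem_finsupport w).mp ha, fun b hb => h b ((ρ.mem_finsupport w).mpr hb)⟩

/-- Closed supports are used here: the points active near w₀ are among those whose closed support
contains w₀. The dominating point need not be active. -/
theorem eventually_dominates (hρ : ∀ a (w : D.nbhd), w ∈ tsupport (ρ a) → dist w.1 a.1 < D.rad a)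
    (w₀ : D.nbhd) : ∃ a, ∀ᶠ w in nhds w₀, D.Dominates ρ a w := by
  obtain ⟨a₀, h₀⟩ := ρ.exists_pos (Set.mem_univ w₀)
  obtain ⟨a, -, h⟩ := exists_dominates hρ (w := w₀) (S := ρ.fintsupport w₀)
    ⟨a₀, (ρ.mem_fintsupport_iff w₀ a₀).mpr (subset_closure h₀.ne')⟩
    fun a ha => (ρ.mem_fintsupport_iff w₀ a).mp ha
  refine ⟨a, ?_⟩
  filter_upwards [ρ.eventually_finsupport_subset w₀] with w hw b hb
  exact h b (hw ((ρ.mem_finsupport w).mpr hb))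

/-- The mean of the end points of the paths. -/
def endMean (D : Branches x₀ O i A) (ρ : PartitionOfUnity A D.nbhd Set.univ) (f : X × X → X)
    (w : D.nbhd) : X →ᵇ ℝ := ∑ᶠ b, ρ b w • kuratowski x₀ (f b.1)

theorem continuous_endMean (f : X × X → X) : Continuous (D.endMean ρ f) :=
  ρ.continuous_finsum_smul fun _ _ _ => continuousAt_const

theorem mean_eq_endMean {f : X × X → X} {t : unitInterval}
    (hf : ∀ a j, D.path a j t = f a.1) (a : A) (j : Fin i) (w : D.nbhd) :
    D.mean ρ a j (w, t) = D.endMean ρ f w :=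
  finsum_congr fun b => by rw [hf]

theorem endMean_mem (hρ : ∀ a (w : D.nbhd), w ∈ tsupport (ρ a) → dist w.1 a.1 < D.rad a)
    (hi : 1 ≤ i) (hC : Convex ℝ C) (hCκ : ∀ x, kuratowski x₀ x ∈ C) {f : X × X → X}
    {t : unitInterval} (hf : ∀ a j, D.path a j t = f a.1) (w : D.nbhd) :
    D.endMean ρ f w ∈ O ∩ C := by
  obtain ⟨a, -, ha⟩ := exists_lead hρ w
  rw [← mean_eq_endMean hf a ⟨0, hi⟩]
  exact mean_mem hC hCκ ha _ _

/-- Both ends of the segment lie in the ball of radius `eps a` about an end point of a path at a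
lead a; for the first one this uses `rad_le`. -/
theorem segment_mem (hρ : ∀ a (w : D.nbhd), w ∈ tsupport (ρ a) → dist w.1 a.1 < D.rad a)
    (hi : 1 ≤ i) (hC : Convex ℝ C) (hCκ : ∀ x, kuratowski x₀ x ∈ C) {f : X × X → X}
    (hf1 : ∀ z z', dist (f z) (f z') ≤ dist z z')
    {t : unitInterval} (hf : ∀ a j, D.path a j t = f a.1) (w : D.nbhd) (s : unitInterval) :
    (1 - (s : ℝ)) • kuratowski x₀ (f w.1) + (s : ℝ) • D.endMean ρ f w ∈ O ∩ C := by
  have hconv : ∀ {V : Set (X →ᵇ ℝ)}, Convex ℝ V → kuratowski x₀ (f w.1) ∈ V →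
      D.endMean ρ f w ∈ V →
      (1 - (s : ℝ)) • kuratowski x₀ (f w.1) + (s : ℝ) • D.endMean ρ f w ∈ V :=
    fun hV h1 h2 => hV h1 h2 (sub_nonneg.mpr s.2.2) s.2.1 (sub_add_cancel _ _)
  obtain ⟨a, haw, ha⟩ := exists_lead hρ w
  refine ⟨D.ball_subset a ⟨0, hi⟩ t (hconv (convex_ball _ _) ?_ ?_),
    hconv hC (hCκ _) (endMean_mem hρ hi hC hCκ hf w).2⟩
  · rw [Metric.mem_ball, (isometry_kuratowski x₀).dist_eq, hf]
    exact ((hf1 _ _).trans_lt (hρ a w (subset_closure haw))).trans_le (D.rad_le a)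
  · refine finsum_smul_mem (convex_ball _ _) w fun b hb => ?_
    rw [Metric.mem_ball, (isometry_kuratowski x₀).dist_eq, dist_comm,
      ← hf b (D.matching a b ⟨0, hi⟩)]
    exact (ContinuousMap.dist_apply_le_dist t).trans_lt (D.dist_matching (ha b hb) _)

/-- Projection of the neighbourhood of `A` to a factor is homotopic to the retraction of the mean of
the end points. -/
theorem exists_end_homotopy
    (hρ : ∀ a (w : D.nbhd), w ∈ tsupport (ρ a) → dist w.1 a.1 < D.rad a)
    (hi : 1 ≤ i) (hC : Convex ℝ C) (hCκ : ∀ x, kuratowski x₀ x ∈ C) {r : (X →ᵇ ℝ) → X}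
    (hr : ContinuousOn r (O ∩ C)) (hrκ : ∀ x, r (kuratowski x₀ x) = x) {f : X × X → X}
    (hf1 : ∀ z z', dist (f z) (f z') ≤ dist z z')
    {t : unitInterval} (hf : ∀ a j, D.path a j t = f a.1) :
    ∃ (g : C(D.nbhd, X)) (H : C(D.nbhd × unitInterval, X)), (∀ w, g w = r (D.endMean ρ f w)) ∧
      (∀ w, H (w, 0) = f w.1) ∧ ∀ w, H (w, 1) = g w := by
  have hfc : Continuous f := (LipschitzWith.of_dist_le_mul (K := 1) fun z z' => by
    simpa using hf1 z z').continuous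
  refine ⟨⟨fun w => r (D.endMean ρ f w), hr.comp_continuous (continuous_endMean f)
      (endMean_mem hρ hi hC hCκ hf)⟩,
    ⟨fun p => r ((1 - (p.2 : ℝ)) • kuratowski x₀ (f p.1.1) + (p.2 : ℝ) • D.endMean ρ f p.1),
      hr.comp_continuous ?_ fun p => segment_mem hρ hi hC hCκ hf1 hf p.1 p.2⟩,
    fun w => rfl, fun w => ?_, fun w => ?_⟩
  · have h1 : Continuous fun p : D.nbhd × unitInterval => kuratowski x₀ (f p.1.1) :=
      (isometry_kuratowski x₀).continuous.comp
        (hfc.comp (continuous_subtype_val.comp continuous_fst))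
    have h2 : Continuous fun p : D.nbhd × unitInterval => D.endMean ρ f p.1 :=
      (continuous_endMean f).comp continuous_fst
    have h3 : Continuous fun p : D.nbhd × unitInterval => (p.2 : ℝ) :=
      continuous_subtype_val.comp continuous_snd
    exact ((continuous_const.sub h3).smul h1).add (h3.smul h2)
  · change r ((1 - (0 : ℝ)) • kuratowski x₀ (f w.1) + (0 : ℝ) • D.endMean ρ f w) = _
    rw [sub_zero, one_smul, zero_smul, add_zero, hrκ]
  · change r ((1 - (1 : ℝ)) • kuratowski x₀ (f w.1) + (1 : ℝ) • D.endMean ρ f w) = _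
    rw [sub_self, one_smul, zero_smul, zero_add]
    rfl

/-- The two retracted means of end points become homotopic in the symmetric power. -/
theorem exists_symPower_homotopy
    (hρ : ∀ a (w : D.nbhd), w ∈ tsupport (ρ a) → dist w.1 a.1 < D.rad a)
    (hC : Convex ℝ C) (hCκ : ∀ x, kuratowski x₀ x ∈ C) {r : (X →ᵇ ℝ) → X}
    (hr : ContinuousOn r (O ∩ C)) {m : ℕ} (hm : i ∣ m) {g₀ g₁ : C(D.nbhd, X)}
    (h₀ : ∀ w, g₀ w = r (D.endMean ρ Prod.fst w)) (h₁ : ∀ w, g₁ w = r (D.endMean ρ Prod.snd w)) :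
    ∃ H : C(D.nbhd × unitInterval, SymPower m (X × X)),
      (∀ w, H (w, 0) = symDiag m (X × X) (g₀ w, w.1.2)) ∧
        ∀ w, H (w, 1) = symDiag m (X × X) (g₁ w, w.1.2) := by
  obtain ⟨l, rfl⟩ := hm
  -- Each of the i means is repeated l times.
  let e : Fin (i * l) ≃ Fin i × Fin l := finProdFinEquiv.symm
  choose lead hlead hdom using exists_lead hρ
  let G (a : A) (p : D.nbhd × unitInterval) : Fin (i * l) → X × X :=
    fun k => (r (D.mean ρ a (e k).1 p), p.1.1.2)
  have hG : ∀ (a : A) (p : D.nbhd × unitInterval), D.Dominates ρ a p.1 →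
      Quotient.mk (permSetoid (i * l) (X × X)) (G (lead p.1) p) =
        Quotient.mk (permSetoid (i * l) (X × X)) (G a p) := by
    intro a p ha
    have hab := ha _ (hlead p.1)
    refine Quotient.sound ⟨(e.trans ((D.matching a (lead p.1)).prodCongr (Equiv.refl _))).trans
      e.symm, ?_⟩
    funext k
    simp only [G, Function.comp_apply, Equiv.trans_apply, Equiv.apply_symm_apply,
      Equiv.prodCongr_apply, Prod.map_fst]
    rw [mean_matching ha (hdom p.1) hab]
  refine ⟨⟨fun p => Quotient.mk (permSetoid (i * l) (X × X)) (G (lead p.1) p),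
    continuous_iff_continuousAt.mpr fun p₀ => ?_⟩, fun w => ?_, fun w => ?_⟩
  -- The lead may jump, but near p₀ it can be replaced by one fixed dominating point without
  -- changing the orbit, by `hG`.
  · obtain ⟨a, ha⟩ := eventually_dominates hρ p₀.1
    have ha' : ∀ᶠ p in nhds p₀, D.Dominates ρ a p.1 := continuous_fst.continuousAt.eventually ha
    refine ContinuousAt.congr ?_ (ha'.mono fun p hp => (hG a p hp).symm)
    refine (continuous_quotient_mk' (s := permSetoid (i * l) (X × X))).continuousAt.comp ?_
    refine continuousAt_pi.mpr fun k => ContinuousAt.prodMk ?_ ?_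
    · exact (hr.continuousWithinAt (mean_mem hC hCκ ha'.self_of_nhds _ _)).tendsto.comp
        (tendsto_nhdsWithin_iff.mpr ⟨(D.continuous_mean ρ a _).continuousAt,
          ha'.mono fun p hp => mean_mem hC hCκ hp _ _⟩)
    · exact (continuous_snd.comp (continuous_subtype_val.comp continuous_fst)).continuousAt
  · refine congrArg (Quotient.mk (permSetoid (i * l) (X × X))) (funext fun k => ?_)
    change (r (D.mean ρ (lead w) (e k).1 (w, 0)), w.1.2) = _
    rw [h₀, mean_eq_endMean (f := Prod.fst) D.path_zero]
  · refine congrArg (Quotient.mk (permSetoid (i * l) (X × X))) (funext fun k => ?_)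
    change (r (D.mean ρ (lead w) (e k).1 (w, 1)), w.1.2) = _
    rw [h₁, mean_eq_endMean (f := Prod.snd) D.path_one]

/-- A zero-divisor that comes from the symmetric power vanishes on a neighbourhood of `A`. -/
theorem pullback_nbhd_eq_zero {R : Type v} [Ring R] (D : Branches x₀ O i A) (hi : 1 ≤ i)
    (hC : Convex ℝ C) (hCκ : ∀ x, kuratowski x₀ x ∈ C) {r : (X →ᵇ ℝ) → X}
    (hr : ContinuousOn r (O ∩ C)) (hrκ : ∀ x, r (kuratowski x₀ x) = x) {m : ℕ} (hm : i ∣ m)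
    {k : ℕ} (hk : 1 ≤ k) (α : Cohomology (SymPower m (X × X)) R k)
    (hα : pullback R (diag X) k (pullback R (symDiag m (X × X)) k α) = 0) :
    pullback R (subspaceIncl D.nbhd) k (pullback R (symDiag m (X × X)) k α) = 0 := by
  obtain ⟨ρ, hρ⟩ := D.exists_partitionOfUnity
  obtain ⟨g₀, H₀, hg₀, h00, h01⟩ := exists_end_homotopy hρ hi hC hCκ hr hrκ (f := Prod.fst)
    (fun z z' => le_max_left _ _) D.path_zero
  obtain ⟨g₁, H₁, hg₁, h10, h11⟩ := exists_end_homotopy hρ hi hC hCκ hr hrκ (f := Prod.snd)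
    (fun z z' => le_max_right _ _) D.path_one
  obtain ⟨H, hH0, hH1⟩ := exists_symPower_homotopy hρ hC hCκ hr hm hg₀ hg₁
  let q : C(D.nbhd, X) := ⟨fun w => w.1.2, continuous_snd.comp continuous_subtype_val⟩
  let q' : C(D.nbhd × unitInterval, X) := q.comp ⟨Prod.fst, continuous_fst⟩
  -- With w = (x,y), the chain is (x,y) ≃ (g₀ w, y), then δ(g₀ w, y) ≃ δ(g₁ w, y) in the symmetric
  -- power, and (g₁ w, y) ≃ (y,y) = Δ(y).
  have e1 := pullback_eq_of_homotopy (R := R) (H₀.prodMk q') (f := subspaceIncl D.nbhd)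
    (g := g₀.prodMk q) (fun w => Prod.ext (h00 w) rfl) (fun w => Prod.ext (h01 w) rfl) hk
    (pullback R (symDiag m (X × X)) k α)
  have e2 := pullback_eq_of_homotopy (R := R) H (f := (symDiag m (X × X)).comp (g₀.prodMk q))
    (g := (symDiag m (X × X)).comp (g₁.prodMk q)) hH0 hH1 hk α
  have e3 := pullback_eq_of_homotopy (R := R) (H₁.prodMk q') (f := (diag X).comp q)
    (g := g₁.prodMk q) (fun w => Prod.ext (h10 w) rfl) (fun w => Prod.ext (h11 w) rfl) hk
    (pullback R (symDiag m (X × X)) k α)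
  rw [e1, pullback_comp, e2, ← pullback_comp, ← e3, ← pullback_comp, hα, map_zero]

end Branches

end DistTC

end

/-! ### The cover of X × X by neighbourhoods of the strata -/

theorem mainTheorem1 {X : Type u} [MetricSpace X] [PathConnectedSpace X] (hX : DistTC.IsANR X)
    {R : Type v} [Ring R] (n : ℕ) (k : Fin n → ℕ) (hk : ∀ i, 1 ≤ k i)
    (βs : (i : Fin n) →
      DistTC.Cohomology (DistTC.SymPower (Nat.factorial n) (X × X)) R (k i))
    (β : (i : Fin n) → DistTC.Cohomology (X × X) R (k i))
    (hβ : ∀ i, β i =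
      DistTC.pullback R (DistTC.symDiag (Nat.factorial n) (X × X)) (k i) (βs i))
    (hzero : ∀ i, DistTC.pullback R (DistTC.diag X) (k i) (β i) = 0)
    (hcup : DistTC.iteratedCup k rfl β ≠ 0) :
    (n : ℕ∞) ≤ DistTC.dTC X := by
  refine le_sInf ?_
  rintro _ ⟨m, rfl, s, hs, hsupp⟩
  by_contra hlt
  have hmn : m + 1 ≤ n := by
    rw [not_le, Nat.cast_lt] at hlt
    exact hlt
  apply hcup
  choose F hF1 hFm hFpath hFatom hFnull using fun z : X × X =>
    DistTC.exists_atoms (hsupp z.1 z.2)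
  have x₀ : X := (PathConnectedSpace.nonempty (X := X)).some
  obtain ⟨C, O, r, hC, hO, hκ, hr, hrκ⟩ := hX.exists_retraction x₀
  -- The index i stands for i + 1 atoms: the numbers 1, …, n exhaust the possible cardinalities, and
  -- each divides n!.
  have D : ∀ i : Fin n, DistTC.Branches x₀ O (i + 1) {z | (F z).card = i + 1} := fun i =>
    (DistTC.exists_branches x₀ hO (fun x => (hκ x).1) hFpath
      (fun a ε hε => DistTC.eventually_atoms_close hs hFatom hFnull a hε) (i + 1)).some
  refine DistTC.iteratedCup_eq_zero (by omega) k hk (fun i => (D i).isOpen_nbhd) (fun z => ?_) β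
    fun i => ?_
  · have h1 := hF1 z
    have h2 := hFm z
    refine ⟨⟨(F z).card - 1, by omega⟩, (D _).subset_nbhd ?_⟩
    change (F z).card = (F z).card - 1 + 1
    omega
  · have h := hzero i
    rw [hβ i] at h ⊢
    exact (D i).pullback_nbhd_eq_zero (by omega) hC (fun x => (hκ x).2) hr hrκ
      (Nat.dvd_factorial (by omega) (by omega)) (hk i) (βs i) h
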